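/- Let $N\ge 2$, $p>1$ and $\beta\in\mathbb R$, and put $\beta_0=\frac{N-p}{p-1}$. There is a constant $c>0$, depending only on $p$, $N$ and $\beta$, with the following property. Let $S$ be a domain (non-empty connected open subset) of the unit sphere $S^{N-1}$ of $\mathbb R^N$, let $\nabla'$ and $\operatorname{div}'$ be the covariant gradient and the divergence on $S^{N-1}$ for the metric induced by $\mathbb R^N$, let $dS$ be the surface measure, and let $W_0^{1,p}(S)$ be the closure of $C_c^\infty(S)$ in $W^{1,p}(S)$. Let $\omega\in W_0^{1,p}(S)$ be a weak solution of $$-\operatorname{div}'\Big(\big(\beta^2\omega^2+|\nabla'\omega|^2\big)^{\frac{p-2}2}\nabla'\omega\Big)=(p-1)\beta(\beta-\beta_0)\big(\beta^2\omega^2+|\nabla'\omega|^2\big)^{\frac{p-2}2}\omega\quad\text{in }S,\qquad \omega=0\ \text{ on }\partial S,$$ that is, for all $\phi\in C_c^\infty(S)$, $$\int_S\big(\beta^2\omega^2+|\nabla'\omega|^2\big)^{\frac{p-2}2}\langle\nabla'\omega,\nabla'\phi\rangle\,dS=(p-1)\beta(\beta-\beta_0)\int_S\big(\beta^2\omega^2+|\nabla'\omega|^2\big)^{\frac{p-2}2}\omega\,\phi\,dS,$$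 where the fields $(\beta^2\omega^2+|\nabla'\omega|^2)^{\frac{p-2}2}\nabla'\omega$ and $(\beta^2\omega^2+|\nabla'\omega|^2)^{\frac{p-2}2}\omega$ are taken to be $0$ where $\omega$ and $\nabla'\omega$ both vanish. Then: - if $p>N-1$, then, after modification on a null set, $\omega$ satisfies $\|\omega\|_{C^\gamma(S)}\le c\,\|\omega\|_{L^p(S)}$ with $\gamma=1-\frac{N-1}p$, where $\|u\|_{C^\gamma(S)}=\sup_{S}|u|+\sup_{x,y\in S,\,x\ne y}\frac{|u(x)-u(y)|}{|x-y|^\gamma}$; - if $1<p\le N-1$, then $\|\omega\|_{L^\infty(S)}\le c\,\|\omega\|_{L^p(S)}$. -/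

import Mathlib

open MeasureTheory Metric Filter Topology
open scoped ENNReal NNReal

/-- The unit sphere `S^{N-1}` of `ℝ^N` (with the metric, topology and Borel structure induced
by `ℝ^N`). -/
abbrev USphere (N : ℕ) : Type :=
  sphere (0 : EuclideanSpace ℝ (Fin N)) 1

/-- The surface measure `dS` on `S^{N-1}`. -/
noncomputable def surfaceMeasure (N : ℕ) : Measure (USphere N) :=
  (volume : Measure (EuclideanSpace ℝ (Fin N))).toSphere

/-- The radial projection `x ↦ x / |x|` of `ℝ^N ∖ {0}` onto the unit sphere. -/
noncomputable def radialProj {N : ℕ} (x : EuclideanSpace ℝ (Fin N)) (hx : x ≠ 0) : USphere N :=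
  ⟨‖x‖⁻¹ • x, by
    rw [mem_sphere_zero_iff_norm, norm_smul, norm_inv, norm_norm,
      inv_mul_cancel₀ (norm_ne_zero_iff.mpr hx)]⟩

open Classical in
/-- The extension of a function on the sphere to `ℝ^N ∖ {0}` that is constant along rays,
`x ↦ φ (x / |x|)` (with the irrelevant value `0` at the origin). -/
noncomputable def radialExt {N : ℕ} (φ : USphere N → ℝ) (x : EuclideanSpace ℝ (Fin N)) : ℝ :=
  if hx : x ≠ 0 then φ (radialProj x hx) else 0

/-- Smoothness (`C^∞`) of a function on the sphere: its extension constant along rays is smooth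
away from the origin. -/
def SphereSmooth {N : ℕ} (φ : USphere N → ℝ) : Prop :=
  ContDiffOn ℝ (⊤ : ℕ∞) (radialExt φ) {0}ᶜ

/-- The covariant gradient `∇'φ` on the sphere with the metric induced from `ℝ^N`, as a vector of
`ℝ^N` tangent to the sphere. As the extension of `φ` is constant along rays, its Euclidean gradient
at a point `σ` of the sphere has no radial component and its tangential part is `∇'φ σ`. -/
noncomputable def sphereGrad {N : ℕ} (φ : USphere N → ℝ) (σ : USphere N) :
    EuclideanSpace ℝ (Fin N) :=
  gradient (radialExt φ) (σ : EuclideanSpace ℝ (Fin N))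

/-- The test functions `C_c^∞(S)`: smooth functions on the sphere whose (automatically compact)
support lies in `S`. -/
def IsTestFunction {N : ℕ} (S : Set (USphere N)) (φ : USphere N → ℝ) : Prop :=
  SphereSmooth φ ∧ tsupport φ ⊆ S

/-- `ω` belongs to `W_0^{1,p}(S)`, the closure of `C_c^∞(S)` for the norm of `W^{1,p}(S)`, and `G`
is its gradient `∇'ω`: `ω` and `G` are the limits in `L^p(S)` of `φ_n` and `∇'φ_n` for some
sequence of test functions `φ_n`. (The operator `∇'` being closable in `L^p`, the field `G` is
determined by `ω` up to a null set; it is the weak gradient of `ω`.) -/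
structure HasW0Gradient {N : ℕ} (p : ℝ) (S : Set (USphere N)) (ω : USphere N → ℝ)
    (G : USphere N → EuclideanSpace ℝ (Fin N)) : Prop where
  memLp : MemLp ω (ENNReal.ofReal p) ((surfaceMeasure N).restrict S)
  memLp_grad : MemLp G (ENNReal.ofReal p) ((surfaceMeasure N).restrict S)
  approx : ∃ φ : ℕ → USphere N → ℝ, (∀ n, IsTestFunction S (φ n)) ∧
    Tendsto (fun n => eLpNorm (fun σ => φ n σ - ω σ) (ENNReal.ofReal p)
      ((surfaceMeasure N).restrict S)) atTop (𝓝 0) ∧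
    Tendsto (fun n => eLpNorm (fun σ => sphereGrad (φ n) σ - G σ) (ENNReal.ofReal p)
      ((surfaceMeasure N).restrict S)) atTop (𝓝 0)

/-- The exponent `β₀ = (N - p) / (p - 1)`. -/
noncomputable def betaZero (N : ℕ) (p : ℝ) : ℝ := ((N : ℝ) - p) / (p - 1)

/-- `ω ∈ W_0^{1,p}(S)` is a weak solution of the spherical `p`-harmonic eigenvalue problem
`-div' ((β² ω² + |∇'ω|²)^{(p-2)/2} ∇'ω) = (p-1) β (β-β₀) (β² ω² + |∇'ω|²)^{(p-2)/2} ω` in `S`,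
`ω = 0` on `∂S`. Where `ω` and `∇'ω` both vanish, the two fields
`(β² ω² + |∇'ω|²)^{(p-2)/2} ∇'ω` and `(β² ω² + |∇'ω|²)^{(p-2)/2} ω` are `0`; for `p > 1` both
integrands below are integrable. -/
def IsW0Solution {N : ℕ} (p β : ℝ) (S : Set (USphere N)) (ω : USphere N → ℝ) : Prop :=
  ∃ G : USphere N → EuclideanSpace ℝ (Fin N), HasW0Gradient p S ω G ∧
    ∀ φ : USphere N → ℝ, IsTestFunction S φ →
      ∫ σ in S, (β ^ 2 * ω σ ^ 2 + ‖G σ‖ ^ 2) ^ ((p - 2) / 2) * inner ℝ (G σ) (sphereGrad φ σ)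
          ∂(surfaceMeasure N) =
        (p - 1) * β * (β - betaZero N p) *
          ∫ σ in S, (β ^ 2 * ω σ ^ 2 + ‖G σ‖ ^ 2) ^ ((p - 2) / 2) * ω σ * φ σ
            ∂(surfaceMeasure N)

/-- The norm of `C^γ(S)` (possibly infinite): the supremum of `|u|` over `S` plus the
`γ`-Hölder seminorm of `u` on `S`. -/
noncomputable def holderNormOn {N : ℕ} (γ : ℝ) (S : Set (USphere N)) (u : USphere N → ℝ) : ℝ≥0∞ :=
  (⨆ σ ∈ S, ‖u σ‖ₑ) + eHolderNorm γ.toNNReal (S.domRestrict u)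

/-!
Testing the equation with `F(ω)`, where `F' = (ε + ω² / (1 + δω²))^r`, and absorbing the zero-order
term gives the weighted energy estimate `∫ |∇'ω|^p F'(ω) ≤ C ∫ |ω|^p F'(ω)` with `C` independent of
`F` and of the domain. For `F = id` it reads `‖∇'ω‖_p^p ≤ C ‖ω‖_p^p`, and Morrey's inequality on the
sphere settles the case `p > N - 1`. When `p < N`, letting `δ → 0`, the estimate and a Sobolev
inequality with gain `χ = N / (N - p)` bound the `L^{χps}` norm of `√(ε + ω²)` by its `L^{ps}` norm
for every `s ≥ 1`; Moser's iteration over `s = χ^k`, followed by `ε → 0`, bounds `‖ω‖_∞`.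

Both functional inequalities are those of `ℝ^N` applied to extensions constant along rays: Sobolev's
after a cut-off to a shell, Morrey's on balls centred on the sphere.
-/

section SphereCalculus

variable {N : ℕ} {φ : USphere N → ℝ}

theorem radialExt_of_ne_zero (φ : USphere N → ℝ) {x : EuclideanSpace ℝ (Fin N)} (hx : x ≠ 0) :
    radialExt φ x = φ (radialProj x hx) :=
  dif_pos hx

theorem radialProj_coe (σ : USphere N) :
    radialProj (σ : EuclideanSpace ℝ (Fin N)) (ne_zero_of_mem_unit_sphere σ) = σ :=
  Subtype.ext (by simp [radialProj])

theorem homeomorphUnitSphereProd_fst (x : ({0}ᶜ : Set (EuclideanSpace ℝ (Fin N)))) :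
    (homeomorphUnitSphereProd (EuclideanSpace ℝ (Fin N)) x).1 = radialProj x.1 x.2 :=
  Subtype.ext (by simp [radialProj])

theorem radialExt_coe (φ : USphere N → ℝ) (σ : USphere N) :
    radialExt φ (σ : EuclideanSpace ℝ (Fin N)) = φ σ := by
  rw [radialExt_of_ne_zero φ (ne_zero_of_mem_unit_sphere σ), radialProj_coe]

theorem radialExt_smul (φ : USphere N → ℝ) {c : ℝ} (hc : 0 < c) (x : EuclideanSpace ℝ (Fin N)) :
    radialExt φ (c • x) = radialExt φ x := by
  by_cases hx : x = 0
  · simp [hx]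
  · have hcx : c • x ≠ 0 := smul_ne_zero hc.ne' hx
    have hproj : radialProj (c • x) hcx = radialProj x hx := by
      refine Subtype.ext ?_
      simp only [radialProj, norm_smul, Real.norm_of_nonneg hc.le, smul_smul]
      field_simp
    rw [radialExt_of_ne_zero φ hx, radialExt_of_ne_zero φ hcx, hproj]

theorem radialExt_comp (W : ℝ → ℝ) (φ : USphere N → ℝ) {x : EuclideanSpace ℝ (Fin N)}
    (hx : x ≠ 0) : radialExt (W ∘ φ) x = W (radialExt φ x) := by
  simp only [radialExt_of_ne_zero _ hx, Function.comp_apply]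

theorem fderiv_radialExt_smul (φ : USphere N → ℝ) {c : ℝ} (hc : 0 < c)
    (x : EuclideanSpace ℝ (Fin N)) :
    fderiv ℝ (radialExt φ) x = c • fderiv ℝ (radialExt φ) (c • x) := by
  have hinv : (fun y => radialExt φ (c • y)) = radialExt φ := funext (radialExt_smul φ hc)
  rw [← fderiv_comp_smul, hinv]

theorem norm_sphereGrad (φ : USphere N → ℝ) (σ : USphere N) :
    ‖sphereGrad φ σ‖ = ‖fderiv ℝ (radialExt φ) (σ : EuclideanSpace ℝ (Fin N))‖ := by
  simp [sphereGrad, gradient]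

theorem norm_fderiv_radialExt (φ : USphere N → ℝ) {x : EuclideanSpace ℝ (Fin N)} (hx : x ≠ 0) :
    ‖fderiv ℝ (radialExt φ) x‖ = ‖x‖⁻¹ * radialExt (fun σ => ‖sphereGrad φ σ‖) x := by
  have hx' : 0 < ‖x‖⁻¹ := inv_pos.mpr (norm_pos_iff.mpr hx)
  rw [fderiv_radialExt_smul φ hx', norm_smul, norm_inv, norm_norm, radialExt_of_ne_zero _ hx,
    norm_sphereGrad]
  rfl

theorem SphereSmooth.contDiffAt (hφ : SphereSmooth φ) {x : EuclideanSpace ℝ (Fin N)}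
    (hx : x ≠ 0) : ContDiffAt ℝ (⊤ : ℕ∞) (radialExt φ) x :=
  ContDiffOn.contDiffAt hφ (isOpen_compl_singleton.mem_nhds hx)

theorem SphereSmooth.differentiableAt (hφ : SphereSmooth φ) {x : EuclideanSpace ℝ (Fin N)}
    (hx : x ≠ 0) : DifferentiableAt ℝ (radialExt φ) x :=
  (hφ.contDiffAt hx).differentiableAt (by simp)

theorem SphereSmooth.continuous (hφ : SphereSmooth φ) : Continuous φ :=
  (hφ.continuousOn.comp_continuous continuous_subtype_val ne_zero_of_mem_unit_sphere).congr
    (radialExt_coe φ)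

theorem SphereSmooth.continuousOn_fderiv (hφ : SphereSmooth φ) :
    ContinuousOn (fderiv ℝ (radialExt φ)) {0}ᶜ :=
  ContDiffOn.continuousOn_fderiv_of_isOpen hφ isOpen_compl_singleton (by simp)

theorem SphereSmooth.continuous_sphereGrad (hφ : SphereSmooth φ) : Continuous (sphereGrad φ) :=
  (LinearIsometryEquiv.continuous _).comp
    (hφ.continuousOn_fderiv.comp_continuous continuous_subtype_val ne_zero_of_mem_unit_sphere)

theorem SphereSmooth.comp (hφ : SphereSmooth φ) {W : ℝ → ℝ} (hW : ContDiff ℝ (⊤ : ℕ∞) W) :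
    SphereSmooth (W ∘ φ) :=
  (hW.comp_contDiffOn hφ).congr fun _ hx => radialExt_comp W φ hx

theorem SphereSmooth.sphereGrad_comp (hφ : SphereSmooth φ) {W : ℝ → ℝ} (hW : Differentiable ℝ W)
    (σ : USphere N) : sphereGrad (W ∘ φ) σ = deriv W (φ σ) • sphereGrad φ σ := by
  have hσ := ne_zero_of_mem_unit_sphere σ
  have hcomp : radialExt (W ∘ φ) =ᶠ[𝓝 (σ : EuclideanSpace ℝ (Fin N))] W ∘ radialExt φ := by
    filter_upwards [isOpen_compl_singleton.mem_nhds hσ] with x hx using radialExt_comp W φ hx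
  have hchain := (hW (radialExt φ σ)).hasDerivAt.comp_hasFDerivAt (σ : EuclideanSpace ℝ (Fin N))
    (hφ.differentiableAt hσ).hasFDerivAt
  simp [sphereGrad, gradient, hcomp.fderiv_eq, hchain.fderiv, radialExt_coe]

theorem radialExt_eventuallyEq_zero {σ : USphere N} (hσ : φ =ᶠ[𝓝 σ] 0) :
    radialExt φ =ᶠ[𝓝 (σ : EuclideanSpace ℝ (Fin N))] 0 := by
  have hσ0 := ne_zero_of_mem_unit_sphere σ
  have hproj : Tendsto (fun x : ({0}ᶜ : Set (EuclideanSpace ℝ (Fin N))) => radialProj x.1 x.2)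
      (𝓝 ⟨σ, hσ0⟩) (𝓝 σ) := by
    have hcont : Continuous fun x : ({0}ᶜ : Set (EuclideanSpace ℝ (Fin N))) =>
        radialProj x.1 x.2 :=
      (continuous_fst.comp (homeomorphUnitSphereProd _).continuous).congr
        homeomorphUnitSphereProd_fst
    simpa only [radialProj_coe] using hcont.tendsto ⟨σ, hσ0⟩
  have hev := hproj.eventually hσ
  rw [nhds_subtype, eventually_comap] at hev
  filter_upwards [hev, isOpen_compl_singleton.mem_nhds hσ0] with x hx hx0
  rw [radialExt_of_ne_zero φ hx0]
  exact hx ⟨x, hx0⟩ rfl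

theorem sphereGrad_eq_zero_of_notMem_tsupport {σ : USphere N} (hσ : σ ∉ tsupport φ) :
    sphereGrad φ σ = 0 := by
  have h0 := radialExt_eventuallyEq_zero (notMem_tsupport_iff_eventuallyEq.mp hσ)
  simp [sphereGrad, gradient, h0.fderiv_eq]

theorem IsTestFunction.comp {S : Set (USphere N)} (hφ : IsTestFunction S φ) {W : ℝ → ℝ}
    (hW : ContDiff ℝ (⊤ : ℕ∞) W) (hW0 : W 0 = 0) : IsTestFunction S (W ∘ φ) :=
  ⟨hφ.1.comp hW, (closure_mono (Function.support_comp_subset hW0 φ)).trans hφ.2⟩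

end SphereCalculus

section PolarCoordinates

instance {N : ℕ} : IsFiniteMeasure (surfaceMeasure N) :=
  inferInstanceAs (IsFiniteMeasure (volume : Measure (EuclideanSpace ℝ (Fin N))).toSphere)

/-- The open spherical shell `{a < |x| < b}` of `ℝ^N`. -/
def sphereShell (N : ℕ) (a b : ℝ) : Set (EuclideanSpace ℝ (Fin N)) :=
  {x | ‖x‖ ∈ Set.Ioo a b}

theorem isOpen_sphereShell (N : ℕ) (a b : ℝ) : IsOpen (sphereShell N a b) :=
  isOpen_Ioo.preimage continuous_norm

theorem ne_zero_of_mem_sphereShell {N : ℕ} {a b : ℝ} (ha : 0 ≤ a) {x : EuclideanSpace ℝ (Fin N)}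
    (hx : x ∈ sphereShell N a b) : x ≠ 0 :=
  norm_pos_iff.mp (ha.trans_lt hx.1)

/-- The radial factor of the volume of a spherical shell. -/
noncomputable def shellWeight (N : ℕ) (a b : ℝ) : ℝ≥0∞ :=
  ∫⁻ r in Set.Ioo a b, ENNReal.ofReal (r ^ (N - 1))

theorem volumeIoiPow_Ioo (N : ℕ) {a : ℝ} (ha : 0 ≤ a) (b : ℝ) :
    Measure.volumeIoiPow (N - 1) ((↑) ⁻¹' Set.Ioo a b) = shellWeight N a b := by
  have hsub : Set.Ioo a b ⊆ Set.Ioi 0 := fun r hr => ha.trans_lt hr.1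
  rw [Measure.volumeIoiPow, withDensity_apply _ (measurable_subtype_coe measurableSet_Ioo),
    setLIntegral_subtype measurableSet_Ioi _ fun r : ℝ => ENNReal.ofReal (r ^ (N - 1)),
    Subtype.image_preimage_coe, Set.inter_eq_right.mpr hsub, shellWeight]

theorem shellWeight_le (N : ℕ) {a b : ℝ} (ha : 0 ≤ a) (hb : 0 ≤ b) :
    shellWeight N a b ≤ ENNReal.ofReal (b ^ (N - 1) * (b - a)) := by
  rw [ENNReal.ofReal_mul (by positivity), ← Real.volume_Ioo, ← setLIntegral_const]
  refine setLIntegral_mono' measurableSet_Ioo fun r hr => ?_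
  have := ha.trans hr.1.le
  gcongr
  exact hr.2.le

theorem shellWeight_ne_top (N : ℕ) {a b : ℝ} (ha : 0 ≤ a) (hb : 0 ≤ b) : shellWeight N a b ≠ ∞ :=
  ne_top_of_le_ne_top ENNReal.ofReal_ne_top (shellWeight_le N ha hb)

theorem shellWeight_pos (N : ℕ) {a b : ℝ} (ha : 0 ≤ a) (hab : a < b) : 0 < shellWeight N a b := by
  rw [shellWeight, setLIntegral_pos_iff (by fun_prop)]
  have hsupp : Set.Ioo a b ⊆ Function.support fun r : ℝ => ENNReal.ofReal (r ^ (N - 1)) :=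
    fun r hr => (ENNReal.ofReal_pos.mpr (pow_pos (ha.trans_lt hr.1) _)).ne'
  rw [Set.inter_eq_right.mpr hsupp, Real.volume_Ioo]
  exact ENNReal.ofReal_pos.mpr (sub_pos.mpr hab)

theorem sphereShell_eq_image {N : ℕ} {a : ℝ} (ha : 0 ≤ a) (b : ℝ) :
    sphereShell N a b = Subtype.val '' (homeomorphUnitSphereProd (EuclideanSpace ℝ (Fin N)) ⁻¹'
      (Set.univ ×ˢ ((↑) ⁻¹' Set.Ioo a b))) := by
  ext x
  simp only [Set.mem_image, Set.mem_preimage, Set.mem_prod, Set.mem_univ, true_and,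
    homeomorphUnitSphereProd_apply_snd_coe]
  constructor
  · exact fun hx => ⟨⟨x, ne_zero_of_mem_sphereShell ha hx⟩, hx, rfl⟩
  · rintro ⟨y, hy, rfl⟩
    exact hy

theorem setLIntegral_sphereShell {N : ℕ} {f : USphere N → ℝ} (hf : Measurable f) {g : ℝ → ℝ≥0∞}
    (hg : Measurable g) {a : ℝ} (ha : 0 ≤ a) (b : ℝ) :
    ∫⁻ x in sphereShell N a b, g (radialExt f x) =
      shellWeight N a b * ∫⁻ σ, g (f σ) ∂(surfaceMeasure N) := by
  set I : Set (Set.Ioi (0 : ℝ)) := (↑) ⁻¹' Set.Ioo a b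
  have hI : MeasurableSet I := measurable_subtype_coe measurableSet_Ioo
  let polar := homeomorphUnitSphereProd (EuclideanSpace ℝ (Fin N))
  have hpolar : MeasurePreserving polar (volume.comap Subtype.val)
      ((surfaceMeasure N).prod (Measure.volumeIoiPow (N - 1))) := by
    simpa [polar, surfaceMeasure] using
      (volume : Measure (EuclideanSpace ℝ (Fin N))).measurePreserving_homeomorphUnitSphereProd
  calc ∫⁻ x in sphereShell N a b, g (radialExt f x)
      = ∫⁻ x in polar ⁻¹' (Set.univ ×ˢ I), g (radialExt f x.1) ∂(volume.comap Subtype.val) := by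
        rw [sphereShell_eq_image ha, ← setLIntegral_subtype (measurableSet_singleton _).compl]
    _ = ∫⁻ x in polar ⁻¹' (Set.univ ×ˢ I), g (f (polar x).1) ∂(volume.comap Subtype.val) :=
        lintegral_congr fun x => by
          rw [homeomorphUnitSphereProd_fst, radialExt_of_ne_zero f x.2]
    _ = ∫⁻ q in Set.univ ×ˢ I, g (f q.1) ∂(surfaceMeasure N).prod (Measure.volumeIoiPow (N - 1)) :=
        hpolar.setLIntegral_comp_preimage (f := fun q => g (f q.1)) (MeasurableSet.univ.prod hI)
          (by fun_prop)
    _ = shellWeight N a b * ∫⁻ σ, g (f σ) ∂(surfaceMeasure N) := by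
        rw [← Measure.prod_restrict, Measure.restrict_univ, lintegral_prod _ (by fun_prop)]
        simp only [lintegral_const, Measure.restrict_apply_univ]
        rw [lintegral_mul_const _ (by fun_prop), mul_comm, volumeIoiPow_Ioo N ha]

theorem eLpNorm_radialExt {N : ℕ} {f : USphere N → ℝ} (hf : Measurable f) {a p : ℝ} (ha : 0 ≤ a)
    (b : ℝ) (hp : 0 < p) :
    eLpNorm (radialExt f) (ENNReal.ofReal p) (volume.restrict (sphereShell N a b)) =
      shellWeight N a b ^ (1 / p) * eLpNorm f (ENNReal.ofReal p) (surfaceMeasure N) := by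
  have hp0 : ENNReal.ofReal p ≠ 0 := by simpa using hp
  simp only [eLpNorm_eq_lintegral_rpow_enorm_toReal hp0 ENNReal.ofReal_ne_top,
    ENNReal.toReal_ofReal hp.le]
  rw [← ENNReal.mul_rpow_of_nonneg _ _ (by positivity),
    setLIntegral_sphereShell hf (g := fun t => ‖t‖ₑ ^ p) (by fun_prop) ha]

end PolarCoordinates

section Sobolev

variable {N : ℕ}

/-- The (extended) `W^{1,p}` norm of a function `ω` on the sphere with gradient field `G`. -/
noncomputable def sobolevENorm (p : ℝ) (ω : USphere N → ℝ)
    (G : USphere N → EuclideanSpace ℝ (Fin N)) : ℝ≥0∞ :=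
  eLpNorm ω (ENNReal.ofReal p) (surfaceMeasure N) +
    eLpNorm G (ENNReal.ofReal p) (surfaceMeasure N)

theorem exists_sphereShell_cutoff (N : ℕ) :
    ∃ η : EuclideanSpace ℝ (Fin N) → ℝ, ContDiff ℝ 1 η ∧ HasCompactSupport η ∧
      tsupport η ⊆ sphereShell N (1 / 4) 3 ∧ (∀ x ∈ sphereShell N (3 / 4) (3 / 2), η x = 1) ∧
      ∀ x, ‖η x‖ ≤ 1 := by
  set s : Set (EuclideanSpace ℝ (Fin N)) := (sphereShell N (1 / 4) 3)ᶜ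
  set t : Set (EuclideanSpace ℝ (Fin N)) := {x | ‖x‖ ∈ Set.Icc (3 / 4) (3 / 2)}
  have hs : IsClosed s := (isOpen_sphereShell N _ _).isClosed_compl
  have ht : IsClosed t := isClosed_Icc.preimage continuous_norm
  have hst : Disjoint s t := Set.disjoint_left.mpr fun x hxs hxt =>
    hxs ⟨by linarith [hxt.1], by linarith [hxt.2]⟩
  obtain ⟨η, hη0, hη1, hη⟩ := exists_contMDiffMap_zero_one_nhds_of_isClosed
    (modelWithCornersSelf ℝ (EuclideanSpace ℝ (Fin N))) (n := 1) hs ht hst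
  have hsupp : tsupport η ⊆ sphereShell N (1 / 4) 3 := fun x hx => by
    by_contra hxs
    exact notMem_tsupport_iff_eventuallyEq.mpr (hη0.filter_mono (nhds_le_nhdsSet hxs)) hx
  refine ⟨η, η.contMDiff.contDiff, ?_, hsupp, fun x hx => ?_, fun x => ?_⟩
  · refine HasCompactSupport.of_support_subset_isCompact (isCompact_closedBall 0 3) fun x hx => ?_
    exact mem_closedBall_zero_iff.mpr (hsupp (subset_tsupport _ hx)).2.le
  · exact (hη1.filter_mono (nhds_le_nhdsSet (show x ∈ t from ⟨hx.1.le, hx.2.le⟩))).self_of_nhds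
  · rw [Real.norm_of_nonneg (hη x).1]
    exact (hη x).2

theorem contDiff_mul_radialExt {φ : USphere N → ℝ} (hφ : SphereSmooth φ)
    {η : EuclideanSpace ℝ (Fin N) → ℝ} (hη : ContDiff ℝ 1 η)
    (h0 : (0 : EuclideanSpace ℝ (Fin N)) ∉ tsupport η) : ContDiff ℝ 1 (η * radialExt φ) := by
  refine contDiff_iff_contDiffAt.mpr fun x => ?_
  by_cases hx : x ∈ tsupport η
  · have hx0 : x ≠ 0 := fun h => h0 (h ▸ hx)
    exact hη.contDiffAt.mul ((hφ.contDiffAt hx0).of_le (by exact_mod_cast le_top))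
  · have hzero : η * radialExt φ =ᶠ[𝓝 x] 0 :=
      notMem_tsupport_iff_eventuallyEq.mp fun h => hx (tsupport_mul_subset_left h)
    exact contDiffAt_const.congr_of_eventuallyEq hzero

theorem norm_fderiv_mul_radialExt_le {φ : USphere N → ℝ} (hφ : SphereSmooth φ)
    {η : EuclideanSpace ℝ (Fin N) → ℝ} {x : EuclideanSpace ℝ (Fin N)}
    (hη : DifferentiableAt ℝ η x) (hx : x ≠ 0) {K : ℝ} (hK : ‖fderiv ℝ η x‖ ≤ K)
    (hK' : ‖η x‖ * ‖x‖⁻¹ ≤ K) :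
    ‖fderiv ℝ (η * radialExt φ) x‖ ≤
      K * radialExt (fun σ => ‖φ σ‖ + ‖sphereGrad φ σ‖) x := by
  rw [fderiv_mul hη (hφ.differentiableAt hx), add_comm]
  refine (norm_add_le _ _).trans ?_
  rw [norm_smul, norm_smul, norm_fderiv_radialExt φ hx, ← mul_assoc, mul_comm ‖radialExt φ x‖]
  simp only [radialExt_of_ne_zero _ hx, mul_add]
  gcongr

theorem SphereSmooth.eLpNorm_norm_add_norm_sphereGrad_le {φ : USphere N → ℝ} (hφ : SphereSmooth φ)
    {p : ℝ} (hp : 1 ≤ p) :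
    eLpNorm (fun σ => ‖φ σ‖ + ‖sphereGrad φ σ‖) (ENNReal.ofReal p) (surfaceMeasure N) ≤
      sobolevENorm p φ (sphereGrad φ) := by
  refine (eLpNorm_add_le hφ.continuous.norm.aestronglyMeasurable
    hφ.continuous_sphereGrad.norm.aestronglyMeasurable (by simpa using hp)).trans_eq ?_
  rw [eLpNorm_norm, eLpNorm_norm, sobolevENorm]

theorem eLpNorm_fderiv_mul_radialExt_le {φ : USphere N → ℝ} (hφ : SphereSmooth φ)
    {η : EuclideanSpace ℝ (Fin N) → ℝ} (hη : ContDiff ℝ 1 η) {a b : ℝ} (ha : 0 < a)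
    (hsupp : tsupport η ⊆ sphereShell N a b) {K : ℝ≥0} (hK : ∀ x, ‖fderiv ℝ η x‖ ≤ K)
    (hK' : ∀ x, ‖η x‖ ≤ a * K) {p : ℝ} (hp : 1 ≤ p) :
    eLpNorm (fderiv ℝ (η * radialExt φ)) (ENNReal.ofReal p) volume ≤
      K * (shellWeight N a b ^ (1 / p) * sobolevENorm p φ (sphereGrad φ)) := by
  have hp0 : 0 < p := by linarith
  have hF : Measurable fun σ => ‖φ σ‖ + ‖sphereGrad φ σ‖ :=
    (hφ.continuous.norm.add hφ.continuous_sphereGrad.norm).measurable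
  have hsupp' : Function.support (fun x => ‖fderiv ℝ (η * radialExt φ) x‖) ⊆
      sphereShell N a b := fun x hx =>
    hsupp (tsupport_mul_subset_left (support_fderiv_subset ℝ (norm_ne_zero_iff.mp hx)))
  have hgrad : ∀ x ∈ sphereShell N a b, ‖‖fderiv ℝ (η * radialExt φ) x‖‖ ≤
      K * ‖radialExt (fun σ => ‖φ σ‖ + ‖sphereGrad φ σ‖) x‖ := fun x hx => by
    have hx0 := ne_zero_of_mem_sphereShell ha.le hx
    have hη' : ‖η x‖ * ‖x‖⁻¹ ≤ K := by
      rw [mul_inv_le_iff₀ (norm_pos_iff.mpr hx0), mul_comm]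
      exact (hK' x).trans (by gcongr; exact hx.1.le)
    rw [norm_norm]
    refine (norm_fderiv_mul_radialExt_le hφ (hη.differentiable (by simp) x) hx0 (hK x)
      hη').trans ?_
    gcongr
    exact le_abs_self _
  rw [← eLpNorm_norm, ← eLpNorm_restrict_eq_of_support_subset hsupp']
  refine (eLpNorm_le_nnreal_smul_eLpNorm_of_ae_le_mul
    (ae_restrict_of_forall_mem (isOpen_sphereShell N _ _).measurableSet hgrad) _).trans ?_
  rw [ENNReal.smul_def, smul_eq_mul, eLpNorm_radialExt hF ha.le b hp0]
  gcongr
  exact hφ.eLpNorm_norm_add_norm_sphereGrad_le hp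

theorem shellWeight_rpow_mul_eLpNorm_le {φ : USphere N → ℝ} (hφ : Measurable φ)
    {η : EuclideanSpace ℝ (Fin N) → ℝ} {a b : ℝ} (ha : 0 ≤ a)
    (hη : ∀ x ∈ sphereShell N a b, η x = 1) {q : ℝ} (hq : 0 < q) :
    shellWeight N a b ^ (1 / q) * eLpNorm φ (ENNReal.ofReal q) (surfaceMeasure N) ≤
      eLpNorm (η * radialExt φ) (ENNReal.ofReal q) volume := by
  rw [← eLpNorm_radialExt hφ ha b hq]
  refine (eLpNorm_congr_ae ?_).trans_le (eLpNorm_mono_measure _ Measure.restrict_le_self)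
  exact ae_restrict_of_forall_mem (isOpen_sphereShell N _ _).measurableSet fun x hx => by
    rw [Pi.mul_apply, hη x hx, one_mul]

theorem eLpNorm_mul_radialExt_le_eLpNorm_fderiv {φ : USphere N → ℝ} (hφ : SphereSmooth φ)
    {η : EuclideanSpace ℝ (Fin N) → ℝ} (hη : ContDiff ℝ 1 η) (hηc : HasCompactSupport η)
    (h0 : (0 : EuclideanSpace ℝ (Fin N)) ∉ tsupport η) {p : ℝ} (hp : 1 ≤ p) (hpN : p < N) :
    eLpNorm (η * radialExt φ) (ENNReal.ofReal (N / (N - p) * p)) volume ≤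
      eLpNormLESNormFDerivOfEqInnerConst (volume : Measure (EuclideanSpace ℝ (Fin N)))
        p.toNNReal * eLpNorm (fderiv ℝ (η * radialExt φ)) (ENNReal.ofReal p) volume := by
  have hp0 : 0 < p := by linarith
  have hNp : 0 < (N : ℝ) - p := by linarith
  have hN : 0 < (N : ℝ) := by linarith
  refine eLpNorm_le_eLpNorm_fderiv_of_eq_inner volume (contDiff_mul_radialExt hφ hη h0)
    hηc.mul_right (p' := (N / (N - p) * p).toNNReal) (by simpa using hp) (by simpa using hN) ?_
  rw [Real.coe_toNNReal _ (by positivity), NNReal.coe_inv, Real.coe_toNNReal _ hp0.le,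
    finrank_euclideanSpace, Fintype.card_fin]
  field_simp

/-- A Sobolev embedding `W^{1,p} ⊆ L^q` of the sphere with constant `C`, stated on the smooth
functions. -/
def SphereSobolev (N : ℕ) (p q : ℝ) (C : ℝ≥0) : Prop :=
  ∀ φ : USphere N → ℝ, SphereSmooth φ →
    eLpNorm φ (ENNReal.ofReal q) (surfaceMeasure N) ≤ C * sobolevENorm p φ (sphereGrad φ)

-- The Gagliardo-Nirenberg-Sobolev inequality of `ℝ^N`, applied to a cut-off of the radial
-- extension. Its exponent is not the optimal one of the `(N - 1)`-dimensional sphere, but any gain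
-- of integrability is enough for Moser's iteration.
theorem exists_sphereSobolev {p : ℝ} (hp : 1 ≤ p) (hpN : p < N) :
    ∃ C : ℝ≥0, SphereSobolev N p (N / (N - p) * p) C := by
  obtain ⟨η, hη, hηc, hsupp, hη1, hηle⟩ := exists_sphereShell_cutoff N
  obtain ⟨K₀, hK₀⟩ := (hηc.fderiv (𝕜 := ℝ)).exists_bound_of_continuous
    (hη.continuous_fderiv (by simp))
  have : 0 < p := by linarith
  have : 0 < (N : ℝ) - p := by linarith
  have hN0 : 0 < (N : ℝ) := by linarith
  set K : ℝ≥0 := max K₀.toNNReal 4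
  have hK (x : EuclideanSpace ℝ (Fin N)) : ‖fderiv ℝ η x‖ ≤ K :=
    (hK₀ x).trans ((Real.le_coe_toNNReal K₀).trans (by simp [K]))
  have hK' (x : EuclideanSpace ℝ (Fin N)) : ‖η x‖ ≤ 1 / 4 * K := by
    have : (4 : ℝ) ≤ K := by simp [K]
    linarith [hηle x]
  set q := N / (N - p) * p
  have hq0 : 0 < q := by positivity
  set C₁ := eLpNormLESNormFDerivOfEqInnerConst
    (volume : Measure (EuclideanSpace ℝ (Fin N))) p.toNNReal
  set c := shellWeight N (3 / 4) (3 / 2) ^ (1 / q)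
  set d := shellWeight N (1 / 4) 3 ^ (1 / p)
  have hc : c ≠ 0 := (ENNReal.rpow_pos (shellWeight_pos N (by norm_num) (by norm_num))
    (shellWeight_ne_top N (by norm_num) (by norm_num))).ne'
  have hc_top : c ≠ ∞ := ENNReal.rpow_ne_top_of_nonneg (by positivity)
    (shellWeight_ne_top N (by norm_num) (by norm_num))
  have hd : d ≠ ∞ := ENNReal.rpow_ne_top_of_nonneg (by positivity)
    (shellWeight_ne_top N (by norm_num) (by norm_num))
  have hconst : c⁻¹ * (C₁ * (K * d)) ≠ ∞ := by finiteness
  refine ⟨(c⁻¹ * (C₁ * (K * d))).toNNReal, fun φ hφ => ?_⟩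
  have h0 : (0 : EuclideanSpace ℝ (Fin N)) ∉ tsupport η :=
    fun h => ne_zero_of_mem_sphereShell (by norm_num) (hsupp h) rfl
  have hGNS := eLpNorm_mul_radialExt_le_eLpNorm_fderiv hφ hη hηc h0 hp hpN
  have hlower := shellWeight_rpow_mul_eLpNorm_le hφ.continuous.measurable (by norm_num) hη1 hq0
  have hupper := eLpNorm_fderiv_mul_radialExt_le hφ hη (by norm_num) hsupp hK hK' hp
  rw [ENNReal.coe_toNNReal hconst, mul_assoc, mul_comm c⁻¹, ← div_eq_mul_inv,
    ENNReal.le_div_iff_mul_le (.inl hc) (.inl hc_top), mul_comm _ c]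
  calc c * eLpNorm φ (ENNReal.ofReal q) (surfaceMeasure N)
      ≤ C₁ * eLpNorm (fderiv ℝ (η * radialExt φ)) (ENNReal.ofReal p) volume := hlower.trans hGNS
    _ ≤ C₁ * (K * (d * sobolevENorm p φ (sphereGrad φ))) := by gcongr
    _ = C₁ * (K * d) * sobolevENorm p φ (sphereGrad φ) := by ring

end Sobolev

section Morrey

open AffineMap (lineMap homothety homothety_eq_lineMap homothety_continuous hasDerivAt_lineMap
  lineMap_apply_zero lineMap_apply_one)

theorem enorm_mul_measure_le {α F : Type*} [MeasurableSpace α] {μ : Measure α}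
    [SeminormedAddCommGroup F] {s : Set α} {v : α → F}
    (hv : AEMeasurable (fun z => ‖v z‖ₑ) (μ.restrict s)) (c : F) :
    ‖c‖ₑ * μ s ≤ ∫⁻ z in s, ‖v z‖ₑ ∂μ + ∫⁻ z in s, ‖v z - c‖ₑ ∂μ := by
  rw [← setLIntegral_const, ← lintegral_add_left' hv]
  refine lintegral_mono fun z => ?_
  simpa using enorm_sub_le (a := v z) (b := v z - c)

variable {E F : Type*} [NormedAddCommGroup E] [NormedSpace ℝ E] [NormedAddCommGroup F]
  [NormedSpace ℝ F] {u : E → F}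

theorem lineMap_mem_ball {x z : E} {s t : ℝ} (hz : z ∈ ball x s) (ht : t ∈ Set.Icc (0 : ℝ) 1) :
    lineMap x z t ∈ ball x s := by
  have hs : 0 < s := dist_nonneg.trans_lt hz
  exact (convex_ball x s).lineMap_mem (mem_ball_self hs) hz ht

theorem enorm_sub_le_lintegral_enorm_fderiv [CompleteSpace F] {x z : E} {s : ℝ}
    (hu : ContDiffOn ℝ 1 u (ball x s)) (hz : z ∈ ball x s) :
    ‖u z - u x‖ₑ ≤ ∫⁻ t in Set.Ioc (0 : ℝ) 1,
      ENNReal.ofReal s * ‖fderiv ℝ u (lineMap x z t)‖ₑ := by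
  have hderiv : ∀ t ∈ Set.uIcc (0 : ℝ) 1, HasDerivAt (fun t => u (lineMap x z t))
      (fderiv ℝ u (lineMap x z t) (z - x)) t := fun t ht => by
    rw [Set.uIcc_of_le zero_le_one] at ht
    have hdiff := (hu.contDiffAt (isOpen_ball.mem_nhds (lineMap_mem_ball hz ht))).differentiableAt
      one_ne_zero
    exact hdiff.hasFDerivAt.comp_hasDerivAt t hasDerivAt_lineMap
  have hcont : ContinuousOn (fun t : ℝ => fderiv ℝ u (lineMap x z t) (z - x))
      (Set.uIcc (0 : ℝ) 1) := by
    rw [Set.uIcc_of_le zero_le_one]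
    refine ContinuousOn.clm_apply ?_ continuousOn_const
    exact (hu.continuousOn_fderiv_of_isOpen isOpen_ball le_rfl).comp
      (AffineMap.lineMap_continuous.continuousOn) fun t ht => lineMap_mem_ball hz ht
  have hftc := intervalIntegral.integral_eq_sub_of_hasDerivAt hderiv hcont.intervalIntegrable
  rw [lineMap_apply_zero, lineMap_apply_one] at hftc
  rw [← hftc, intervalIntegral.integral_of_le zero_le_one]
  refine (enorm_integral_le_lintegral_enorm _).trans (lintegral_mono fun t => ?_)
  rw [mul_comm]
  refine (ContinuousLinearMap.le_opENorm _ _).trans ?_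
  gcongr
  rw [← ofReal_norm]
  exact ENNReal.ofReal_le_ofReal (mem_ball_iff_norm.mp hz).le

theorem ball_midpoint_subset_left (x y : E) :
    ball (midpoint ℝ x y) (dist x y / 2) ⊆ ball x (dist x y) := by
  refine ball_subset_ball' ?_
  rw [dist_midpoint_left, Real.norm_ofNat]
  linarith

theorem ball_midpoint_subset_right (x y : E) :
    ball (midpoint ℝ x y) (dist x y / 2) ⊆ ball y (dist x y) := by
  rw [midpoint_comm, dist_comm]
  exact ball_midpoint_subset_left y x

variable [MeasurableSpace E] {μ : Measure E}

/-- Morrey's growth condition for the gradient of `u` on the balls about `x` of radius at most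
`R`. -/
structure HasMorreyGrowth (μ : Measure E) (u : E → F) (γ : ℝ) (K : ℝ≥0∞) (R : ℝ) (x : E) :
    Prop where
  contDiffOn : ContDiffOn ℝ 1 u (ball x R)
  lintegral_le : ∀ r, 0 < r → r ≤ R → ∫⁻ z in ball x r, ‖fderiv ℝ u z‖ₑ ∂μ ≤
    K * ENNReal.ofReal (r ^ ((Module.finrank ℝ E : ℝ) - 1 + γ))

theorem HasMorreyGrowth.mono {γ R R' : ℝ} {K : ℝ≥0∞} {x : E} (h : HasMorreyGrowth μ u γ K R x)
    (hR : R' ≤ R) : HasMorreyGrowth μ u γ K R' x :=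
  ⟨h.contDiffOn.mono (ball_subset_ball hR), fun r hr hrR => h.lintegral_le r hr (hrR.trans hR)⟩

variable [FiniteDimensional ℝ E] [BorelSpace E] [μ.IsAddHaarMeasure]

theorem map_homothety_addHaar (x : E) {t : ℝ} (ht : 0 < t) :
    μ.map (homothety x t) = ENNReal.ofReal (t ^ Module.finrank ℝ E)⁻¹ • μ := by
  have hcomp : (homothety x t : E → E) = (· + x) ∘ (t • ·) ∘ (· - x) := by
    ext z
    simp [AffineMap.homothety_apply]
  rw [hcomp, ← Measure.map_map (measurable_add_const x) (by fun_prop),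
    ← Measure.map_map (measurable_const_smul t) (measurable_sub_const x),
    (measurePreserving_sub_right μ x).map_eq, Measure.map_addHaar_smul μ ht.ne',
    Measure.map_smul, (measurePreserving_add_right μ x).map_eq, abs_of_pos (by positivity)]

theorem setLIntegral_ball_comp_lineMap {g : E → ℝ≥0∞} (hg : Measurable g) (x : E) (s : ℝ) {t : ℝ}
    (ht : 0 < t) :
    ∫⁻ z in ball x s, g (lineMap x z t) ∂μ =
      ENNReal.ofReal (t ^ Module.finrank ℝ E)⁻¹ * ∫⁻ z in ball x (t * s), g z ∂μ := by
  have hball : homothety x t ⁻¹' ball x (t * s) = ball x s := by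
    ext z
    rw [Set.mem_preimage, mem_ball, homothety_eq_lineMap, dist_lineMap_left,
      Real.norm_of_nonneg ht.le, mul_lt_mul_iff_right₀ ht, mem_ball']
  have hmap := setLIntegral_map (μ := μ) (measurableSet_ball (x := x) (ε := t * s)) hg
    (homothety_continuous x t).measurable
  rw [map_homothety_addHaar x ht, Measure.restrict_smul, lintegral_smul_measure, hball,
    smul_eq_mul] at hmap
  simp only [hmap, homothety_eq_lineMap]

namespace HasMorreyGrowth

variable {γ R : ℝ} {K : ℝ≥0∞} {x y : E} [CompleteSpace F]

theorem lintegral_fderiv_lineMap_le (h : HasMorreyGrowth μ u γ K R x) {t : ℝ}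
    (ht : t ∈ Set.Ioc (0 : ℝ) 1) (hR : 0 < R) :
    ∫⁻ z in ball x R, ENNReal.ofReal R * ‖fderiv ℝ u (lineMap x z t)‖ₑ ∂μ ≤
      K * ENNReal.ofReal (R ^ (Module.finrank ℝ E + γ)) * ENNReal.ofReal (t ^ (γ - 1)) := by
  set d := Module.finrank ℝ E
  obtain ⟨ht0, ht1⟩ := ht
  have hscale : R * ((t ^ d)⁻¹ * (t * R) ^ ((d : ℝ) - 1 + γ)) = R ^ (d + γ) * t ^ (γ - 1) := by
    rw [Real.mul_rpow ht0.le hR.le, ← Real.rpow_natCast t d, ← Real.rpow_neg ht0.le,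
      show (d : ℝ) + γ = 1 + (d - 1 + γ) by ring, Real.rpow_add hR 1, Real.rpow_one,
      show γ - 1 = -(d : ℝ) + (d - 1 + γ) by ring, Real.rpow_add ht0 (-d)]
    ring
  have hgrowth := h.lintegral_le (t * R) (by positivity) (mul_le_of_le_one_left hR.le ht1)
  have hmeas : Measurable fun z => ‖fderiv ℝ u z‖ₑ := (measurable_fderiv ℝ u).enorm
  rw [lintegral_const_mul' _ _ ENNReal.ofReal_ne_top, setLIntegral_ball_comp_lineMap hmeas x R ht0]
  calc ENNReal.ofReal R * (ENNReal.ofReal (t ^ d)⁻¹ * ∫⁻ z in ball x (t * R), ‖fderiv ℝ u z‖ₑ ∂μ)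
      ≤ ENNReal.ofReal R * (ENNReal.ofReal (t ^ d)⁻¹ *
          (K * ENNReal.ofReal ((t * R) ^ ((d : ℝ) - 1 + γ)))) := by gcongr
    _ = K * ENNReal.ofReal (R * ((t ^ d)⁻¹ * (t * R) ^ ((d : ℝ) - 1 + γ))) := by
        rw [ENNReal.ofReal_mul hR.le, ENNReal.ofReal_mul (by positivity)]
        ring
    _ = K * ENNReal.ofReal (R ^ (d + γ)) * ENNReal.ofReal (t ^ (γ - 1)) := by
        rw [hscale, ENNReal.ofReal_mul (by positivity), mul_assoc]

theorem lintegral_enorm_sub_le (h : HasMorreyGrowth μ u γ K R x) (hγ : 0 < γ)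
    (hR : 0 < R) :
    ∫⁻ z in ball x R, ‖u z - u x‖ₑ ∂μ ≤
      K * ENNReal.ofReal (R ^ (Module.finrank ℝ E + γ)) * ENNReal.ofReal γ⁻¹ := by
  have hpow : ∫⁻ t in Set.Ioc (0 : ℝ) 1, ENNReal.ofReal (t ^ (γ - 1)) = ENNReal.ofReal γ⁻¹ := by
    rw [← ofReal_integral_eq_lintegral_ofReal
        (intervalIntegral.intervalIntegrable_rpow' (by linarith)).1
        (ae_restrict_of_forall_mem measurableSet_Ioc fun t ht => Real.rpow_nonneg ht.1.le _),
      ← intervalIntegral.integral_of_le zero_le_one, integral_rpow (.inl (by linarith))]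
    simp [hγ.ne']
  calc ∫⁻ z in ball x R, ‖u z - u x‖ₑ ∂μ
      ≤ ∫⁻ z in ball x R, ∫⁻ t in Set.Ioc (0 : ℝ) 1,
          ENNReal.ofReal R * ‖fderiv ℝ u (lineMap x z t)‖ₑ ∂volume ∂μ :=
        setLIntegral_mono' measurableSet_ball fun z hz =>
          enorm_sub_le_lintegral_enorm_fderiv h.contDiffOn hz
    _ = ∫⁻ t in Set.Ioc (0 : ℝ) 1, ∫⁻ z in ball x R,
          ENNReal.ofReal R * ‖fderiv ℝ u (lineMap x z t)‖ₑ ∂μ := by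
        refine lintegral_lintegral_swap (Measurable.aemeasurable (.const_mul ?_ _))
        refine ((measurable_fderiv ℝ u).comp (Continuous.measurable ?_)).enorm
        simp only [AffineMap.lineMap_apply_module']
        fun_prop
    _ ≤ ∫⁻ t in Set.Ioc (0 : ℝ) 1, K * ENNReal.ofReal (R ^ (Module.finrank ℝ E + γ)) *
          ENNReal.ofReal (t ^ (γ - 1)) :=
        setLIntegral_mono' measurableSet_Ioc fun t ht => h.lintegral_fderiv_lineMap_le ht hR
    _ = _ := by rw [lintegral_const_mul _ (by fun_prop), hpow]

theorem edist_mul_measure_ball_midpoint_le (hx : HasMorreyGrowth μ u γ K (dist x y) x)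
    (hy : HasMorreyGrowth μ u γ K (dist x y) y) (hγ : 0 < γ) (hxy : x ≠ y) :
    edist (u x) (u y) * μ (ball (midpoint ℝ x y) (dist x y / 2)) ≤
      2 * (K * ENNReal.ofReal (dist x y ^ (Module.finrank ℝ E + γ)) * ENNReal.ofReal γ⁻¹) := by
  set m := midpoint ℝ x y
  set ρ := dist x y
  have hρ : 0 < ρ := dist_pos.mpr hxy
  have hmeas : AEMeasurable (fun z => ‖u z - u x‖ₑ) (μ.restrict (ball m (ρ / 2))) :=
    ((hx.contDiffOn.continuousOn.mono (ball_midpoint_subset_left x y)).sub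
      continuousOn_const).enorm.aemeasurable measurableSet_ball
  calc edist (u x) (u y) * μ (ball m (ρ / 2))
      ≤ ∫⁻ z in ball m (ρ / 2), ‖u z - u x‖ₑ ∂μ + ∫⁻ z in ball m (ρ / 2), ‖u z - u y‖ₑ ∂μ := by
        rw [edist_comm, edist_eq_enorm_sub]
        simpa only [sub_sub_sub_cancel_right] using enorm_mul_measure_le hmeas (u y - u x)
    _ ≤ ∫⁻ z in ball x ρ, ‖u z - u x‖ₑ ∂μ + ∫⁻ z in ball y ρ, ‖u z - u y‖ₑ ∂μ :=
        add_le_add (lintegral_mono_set (ball_midpoint_subset_left x y))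
          (lintegral_mono_set (ball_midpoint_subset_right x y))
    _ ≤ _ := by
        rw [two_mul]
        exact add_le_add (hx.lintegral_enorm_sub_le hγ hρ) (hy.lintegral_enorm_sub_le hγ hρ)

theorem edist_mul_measure_ball_le (hx : HasMorreyGrowth μ u γ K (dist x y) x)
    (hy : HasMorreyGrowth μ u γ K (dist x y) y) (hγ : 0 < γ) :
    edist (u x) (u y) * μ (ball 0 1) ≤
      2 ^ (Module.finrank ℝ E + 1) * ENNReal.ofReal γ⁻¹ * K * ENNReal.ofReal (dist x y ^ γ) := by
  rcases eq_or_ne x y with rfl | hxy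
  · simp
  set d := Module.finrank ℝ E
  set ρ := dist x y
  have hρ : 0 < ρ := dist_pos.mpr hxy
  have hhalf : ENNReal.ofReal ((ρ / 2) ^ d) ≠ 0 := (ENNReal.ofReal_pos.mpr (by positivity)).ne'
  have hpow : ENNReal.ofReal (ρ ^ (d + γ)) =
      ENNReal.ofReal ((ρ / 2) ^ d) * (2 ^ d * ENNReal.ofReal (ρ ^ γ)) := by
    rw [← ENNReal.ofReal_ofNat 2, ← ENNReal.ofReal_pow (by norm_num),
      ← ENNReal.ofReal_mul (by positivity), ← ENNReal.ofReal_mul (by positivity),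
      Real.rpow_add hρ, Real.rpow_natCast, ← mul_assoc, ← mul_pow, div_mul_cancel₀ ρ two_ne_zero]
  have hosc := edist_mul_measure_ball_midpoint_le hx hy hγ hxy
  rw [Measure.addHaar_ball_of_pos μ _ (by positivity), hpow] at hosc
  refine (ENNReal.mul_le_mul_iff_right hhalf ENNReal.ofReal_ne_top).mp ?_
  calc _ = edist (u x) (u y) * (ENNReal.ofReal ((ρ / 2) ^ d) * μ (ball 0 1)) := by ring
    _ ≤ _ := hosc
    _ = _ := by ring

end HasMorreyGrowth

/-- The function `u` is bounded by `A` and Hölder continuous of exponent `γ` with constant `A`. -/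
structure HolderBoundedBy {X : Type*} [PseudoEMetricSpace X] (γ : ℝ) (A : ℝ≥0∞) (u : X → ℝ) :
    Prop where
  enorm_le : ∀ x, ‖u x‖ₑ ≤ A
  edist_le : ∀ x y, edist (u x) (u y) ≤ A * edist x y ^ γ

theorem HolderBoundedBy.mono {X : Type*} [PseudoEMetricSpace X] {γ : ℝ} {A B : ℝ≥0∞} {u : X → ℝ}
    (h : HolderBoundedBy γ A u) (hAB : A ≤ B) : HolderBoundedBy γ B u where
  enorm_le x := (h.enorm_le x).trans hAB
  edist_le x y := (h.edist_le x y).trans (by gcongr)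

theorem HolderBoundedBy.of_edist_le {X : Type*} [PseudoEMetricSpace X] {γ : ℝ} (hγ : 0 ≤ γ)
    {A δ : ℝ≥0∞} (hδ : δ ≠ 0) (hδ' : δ ≠ ∞) {u : X → ℝ} (hu : ∀ x, ‖u x‖ₑ ≤ A)
    (hnear : ∀ x y, edist x y ≤ δ → edist (u x) (u y) ≤ A * edist x y ^ γ) :
    HolderBoundedBy γ ((1 + 2 * δ ^ (-γ)) * A) u where
  enorm_le x := (hu x).trans (le_mul_of_one_le_left' le_self_add)
  edist_le x y := by
    rcases le_or_gt (edist x y) δ with h | h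
    · refine (hnear x y h).trans ?_
      gcongr
      exact le_mul_of_one_le_left' le_self_add
    · have hone : 1 ≤ δ ^ (-γ) * edist x y ^ γ := by
        rw [← ENNReal.rpow_zero (x := δ), ← neg_add_cancel γ, ENNReal.rpow_add _ _ hδ hδ']
        gcongr
      calc edist (u x) (u y) ≤ ‖u x‖ₑ + ‖u y‖ₑ := by
            rw [edist_eq_enorm_sub]
            exact enorm_sub_le
        _ ≤ 2 * A * 1 := by
            rw [mul_one, two_mul]
            exact add_le_add (hu x) (hu y)
        _ ≤ 2 * A * (δ ^ (-γ) * edist x y ^ γ) := by gcongr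
        _ = 2 * δ ^ (-γ) * A * edist x y ^ γ := by ring
        _ ≤ (1 + 2 * δ ^ (-γ)) * A * edist x y ^ γ := by
            gcongr
            exact le_add_self

theorem ball_subset_sphereShell {N : ℕ} (σ : USphere N) (r : ℝ) :
    ball (σ : EuclideanSpace ℝ (Fin N)) r ⊆ sphereShell N (1 - r) (1 + r) := by
  intro z hz
  have hσ : ‖(σ : EuclideanSpace ℝ (Fin N))‖ = 1 := norm_eq_of_mem_sphere σ
  have hz' := (abs_norm_sub_norm_le z σ).trans_lt (mem_ball_iff_norm.mp hz)
  rw [hσ, abs_lt] at hz'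
  exact ⟨by linarith, by linarith⟩

theorem contDiffOn_radialExt_ball {N : ℕ} {φ : USphere N → ℝ} (hφ : SphereSmooth φ)
    (σ : USphere N) {r : ℝ} (hr : r ≤ 1) : ContDiffOn ℝ 1 (radialExt φ) (ball σ r) :=
  (ContDiffOn.of_le hφ (by exact_mod_cast le_top)).mono fun _ hz =>
    ne_zero_of_mem_sphereShell (sub_nonneg.mpr hr) (ball_subset_sphereShell σ r hz)

theorem eLpNorm_fderiv_radialExt_le {N : ℕ} {φ : USphere N → ℝ} (hφ : SphereSmooth φ) {p r : ℝ}
    (hp : 0 < p) (hr : 0 ≤ r) (hr' : r ≤ 1 / 2) :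
    eLpNorm (fderiv ℝ (radialExt φ)) (ENNReal.ofReal p)
        (volume.restrict (sphereShell N (1 - r) (1 + r))) ≤
      2 * (ENNReal.ofReal ((3 / 2) ^ (N - 1) * 2 * r) ^ (1 / p) *
        eLpNorm (sphereGrad φ) (ENNReal.ofReal p) (surfaceMeasure N)) := by
  have hgrad : ∀ x ∈ sphereShell N (1 - r) (1 + r),
      ‖fderiv ℝ (radialExt φ) x‖ ≤ (2 : ℝ≥0) * ‖radialExt (fun σ => ‖sphereGrad φ σ‖) x‖ :=
    fun x hx => by
      have hx0 := ne_zero_of_mem_sphereShell (by linarith) hx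
      rw [norm_fderiv_radialExt φ hx0, NNReal.coe_ofNat]
      refine mul_le_mul ?_ (le_abs_self _) (by simp [radialExt_of_ne_zero _ hx0]) two_pos.le
      rw [inv_le_comm₀ (norm_pos_iff.mpr hx0) two_pos]
      linarith [hx.1]
  have hweight : shellWeight N (1 - r) (1 + r) ≤ ENNReal.ofReal ((3 / 2) ^ (N - 1) * 2 * r) := by
    refine (shellWeight_le N (by linarith) (by linarith)).trans (ENNReal.ofReal_le_ofReal ?_)
    rw [show 1 + r - (1 - r) = 2 * r by ring, ← mul_assoc]
    gcongr
    linarith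
  refine (eLpNorm_le_nnreal_smul_eLpNorm_of_ae_le_mul
    (ae_restrict_of_forall_mem (isOpen_sphereShell N _ _).measurableSet hgrad) _).trans ?_
  rw [ENNReal.smul_def, smul_eq_mul, ENNReal.coe_ofNat, eLpNorm_radialExt
    hφ.continuous_sphereGrad.norm.measurable (by linarith) _ hp, eLpNorm_norm]
  gcongr

-- Hölder's inequality on a ball would give the exponent `1 - N / p`. As the radial extension only
-- sees the thin shell around the sphere, the gain `r ^ (1 / p)` of its width improves it to
-- `1 - (N - 1) / p`.
theorem lintegral_ball_fderiv_radialExt_le {N : ℕ} {φ : USphere N → ℝ} (hφ : SphereSmooth φ)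
    {p : ℝ} (hp : 1 ≤ p) (σ : USphere N) {r : ℝ} (hr : 0 < r) (hr' : r ≤ 1 / 2) :
    ∫⁻ z in ball (σ : EuclideanSpace ℝ (Fin N)) r, ‖fderiv ℝ (radialExt φ) z‖ₑ ≤
      2 * ENNReal.ofReal ((3 / 2) ^ (N - 1) * 2) ^ (1 / p) *
        volume (ball (0 : EuclideanSpace ℝ (Fin N)) 1) ^ (1 - 1 / p) *
        eLpNorm (sphereGrad φ) (ENNReal.ofReal p) (surfaceMeasure N) *
        ENNReal.ofReal (r ^ ((N : ℝ) - 1 + (1 - (N - 1) / p))) := by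
  have hp0 : 0 < p := by linarith
  have hp1 : 0 ≤ 1 - 1 / p := by rwa [sub_nonneg, div_le_one hp0]
  have hpow : ENNReal.ofReal r ^ (1 / p) * ENNReal.ofReal (r ^ N) ^ (1 - 1 / p) =
      ENNReal.ofReal (r ^ ((N : ℝ) - 1 + (1 - (N - 1) / p))) := by
    rw [ENNReal.ofReal_rpow_of_pos hr, ENNReal.ofReal_rpow_of_pos (by positivity),
      ← ENNReal.ofReal_mul (by positivity), ← Real.rpow_natCast r N, ← Real.rpow_mul hr.le,
      ← Real.rpow_add hr]
    congr 2
    field_simp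
    ring
  have hHolder := eLpNorm_le_eLpNorm_mul_rpow_measure_univ
    (μ := volume.restrict (ball (σ : EuclideanSpace ℝ (Fin N)) r)) (p := 1)
    (q := ENNReal.ofReal p) (by simpa using hp)
    (measurable_fderiv ℝ (radialExt φ)).aestronglyMeasurable
  rw [eLpNorm_one_eq_lintegral_enorm, Measure.restrict_apply_univ,
    Measure.addHaar_ball_of_pos volume _ hr, finrank_euclideanSpace, Fintype.card_fin,
    ENNReal.toReal_ofReal hp0.le, ENNReal.toReal_one, div_one] at hHolder
  have hshell := (eLpNorm_mono_measure (fderiv ℝ (radialExt φ)) (Measure.restrict_mono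
    (ball_subset_sphereShell σ r) le_rfl)).trans (eLpNorm_fderiv_radialExt_le hφ hp0 hr.le hr')
  refine hHolder.trans ((mul_le_mul_left hshell _).trans_eq ?_)
  rw [← hpow, ENNReal.ofReal_mul (by positivity), ENNReal.mul_rpow_of_nonneg _ _ (by positivity),
    ENNReal.mul_rpow_of_nonneg _ _ hp1]
  ring

theorem exists_hasMorreyGrowth_radialExt (N : ℕ) {p : ℝ} (hp : 1 ≤ p) :
    ∃ C : ℝ≥0, ∀ φ : USphere N → ℝ, SphereSmooth φ → ∀ σ : USphere N,
      HasMorreyGrowth volume (radialExt φ) (1 - ((N : ℝ) - 1) / p)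
        (C * eLpNorm (sphereGrad φ) (ENNReal.ofReal p) (surfaceMeasure N)) (1 / 2) σ := by
  set C := 2 * ENNReal.ofReal ((3 / 2) ^ (N - 1) * 2) ^ (1 / p) *
    volume (ball (0 : EuclideanSpace ℝ (Fin N)) 1) ^ (1 - 1 / p)
  have hC : C ≠ ∞ := by
    have hp1 : 0 ≤ 1 - 1 / p := by rwa [sub_nonneg, div_le_one (by linarith)]
    finiteness
  refine ⟨C.toNNReal, fun φ hφ σ => ⟨contDiffOn_radialExt_ball hφ σ (by norm_num),
    fun r hr hr' => ?_⟩⟩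
  rw [ENNReal.coe_toNNReal hC, finrank_euclideanSpace, Fintype.card_fin]
  exact lintegral_ball_fderiv_radialExt_le hφ hp σ hr hr'

theorem one_sub_div_pos {N : ℕ} {p : ℝ} (hp : 0 < p) (hNp : (N : ℝ) - 1 < p) :
    0 < 1 - ((N : ℝ) - 1) / p := by
  rwa [sub_pos, div_lt_one hp]

theorem exists_edist_le_of_dist_le_half (N : ℕ) {p : ℝ} (hp : 1 ≤ p) (hNp : (N : ℝ) - 1 < p) :
    ∃ C : ℝ≥0, ∀ φ : USphere N → ℝ, SphereSmooth φ → ∀ σ τ : USphere N, dist σ τ ≤ 1 / 2 →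
      edist (φ σ) (φ τ) ≤ C * eLpNorm (sphereGrad φ) (ENNReal.ofReal p) (surfaceMeasure N) *
        edist σ τ ^ (1 - ((N : ℝ) - 1) / p) := by
  obtain ⟨C, hC⟩ := exists_hasMorreyGrowth_radialExt N hp
  have hγ := one_sub_div_pos (by linarith) hNp
  set γ := 1 - ((N : ℝ) - 1) / p
  set V := volume (ball (0 : EuclideanSpace ℝ (Fin N)) 1)
  have hV : V ≠ 0 := (measure_ball_pos _ _ one_pos).ne'
  have hD : 2 ^ (N + 1) * ENNReal.ofReal γ⁻¹ * C / V ≠ ∞ := by finiteness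
  refine ⟨(2 ^ (N + 1) * ENNReal.ofReal γ⁻¹ * C / V).toNNReal, fun φ hφ σ τ hστ => ?_⟩
  have hosc := HasMorreyGrowth.edist_mul_measure_ball_le ((hC φ hφ σ).mono hστ)
    ((hC φ hφ τ).mono hστ) hγ
  rw [← ENNReal.le_div_iff_mul_le (.inl hV) (.inl measure_ball_lt_top.ne), finrank_euclideanSpace,
    Fintype.card_fin, radialExt_coe, radialExt_coe, ← Subtype.dist_eq,
    ← ENNReal.ofReal_rpow_of_nonneg dist_nonneg hγ.le, ← edist_dist] at hosc
  rw [ENNReal.coe_toNNReal hD]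
  refine hosc.trans_eq ?_
  simp only [div_eq_mul_inv]
  ring

theorem lintegral_ball_radialExt_le {N : ℕ} {φ : USphere N → ℝ} (hφ : Continuous φ) {p : ℝ}
    (hp : 1 ≤ p) (σ : USphere N) {r : ℝ} (hr : r ≤ 1) :
    ∫⁻ z in ball (σ : EuclideanSpace ℝ (Fin N)) r, ‖radialExt φ z‖ₑ ≤
      shellWeight N (1 - r) (1 + r) * (surfaceMeasure N Set.univ ^ (1 - 1 / p) *
        eLpNorm φ (ENNReal.ofReal p) (surfaceMeasure N)) := by
  have hHolder := eLpNorm_le_eLpNorm_mul_rpow_measure_univ (μ := surfaceMeasure N) (p := 1)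
    (q := ENNReal.ofReal p) (by simpa using hp) hφ.aestronglyMeasurable
  rw [eLpNorm_one_eq_lintegral_enorm, ENNReal.toReal_ofReal (by linarith), ENNReal.toReal_one,
    div_one, mul_comm] at hHolder
  calc ∫⁻ z in ball (σ : EuclideanSpace ℝ (Fin N)) r, ‖radialExt φ z‖ₑ
      ≤ ∫⁻ z in sphereShell N (1 - r) (1 + r), ‖radialExt φ z‖ₑ :=
        lintegral_mono_set (ball_subset_sphereShell σ r)
    _ = shellWeight N (1 - r) (1 + r) * ∫⁻ σ, ‖φ σ‖ₑ ∂(surfaceMeasure N) :=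
        setLIntegral_sphereShell hφ.measurable measurable_enorm (sub_nonneg.mpr hr) _
    _ ≤ _ := by gcongr

theorem exists_enorm_le_sobolevENorm (N : ℕ) {p : ℝ} (hp : 1 ≤ p) (hNp : (N : ℝ) - 1 < p) :
    ∃ C : ℝ≥0, ∀ φ : USphere N → ℝ, SphereSmooth φ → ∀ σ : USphere N,
      ‖φ σ‖ₑ ≤ C * sobolevENorm p φ (sphereGrad φ) := by
  obtain ⟨C, hC⟩ := exists_hasMorreyGrowth_radialExt N hp
  have hγ := one_sub_div_pos (by linarith) hNp
  set γ := 1 - ((N : ℝ) - 1) / p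
  set V := volume (ball (0 : EuclideanSpace ℝ (Fin N)) (1 / 2))
  have hV : V ≠ 0 := (measure_ball_pos _ _ (by norm_num)).ne'
  set a := shellWeight N (1 - 1 / 2) (1 + 1 / 2) * surfaceMeasure N Set.univ ^ (1 - 1 / p)
  have ha : a ≠ ∞ := by
    have hp1 : 0 ≤ 1 - 1 / p := by rwa [sub_nonneg, div_le_one (by linarith)]
    exact ENNReal.mul_ne_top (shellWeight_ne_top N (by norm_num) (by norm_num)) (by finiteness)
  set b := C * ENNReal.ofReal ((1 / 2) ^ (N + γ)) * ENNReal.ofReal γ⁻¹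
  have hD : (a + b) / V ≠ ∞ := by finiteness
  refine ⟨((a + b) / V).toNNReal, fun φ hφ σ => ?_⟩
  have hmean := enorm_mul_measure_le (μ := volume) ((contDiffOn_radialExt_ball hφ σ
    one_half_lt_one.le).continuousOn.enorm.aemeasurable measurableSet_ball)
    (radialExt φ (σ : EuclideanSpace ℝ (Fin N)))
  have hosc := (hC φ hφ σ).lintegral_enorm_sub_le hγ one_half_pos
  rw [finrank_euclideanSpace, Fintype.card_fin] at hosc
  rw [radialExt_coe, Measure.addHaar_ball_center] at hmean
  rw [ENNReal.coe_toNNReal hD, ← ENNReal.mul_div_right_comm,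
    ENNReal.le_div_iff_mul_le (.inl hV) (.inl measure_ball_lt_top.ne)]
  calc ‖φ σ‖ₑ * V
      ≤ a * eLpNorm φ (ENNReal.ofReal p) (surfaceMeasure N) +
          b * eLpNorm (sphereGrad φ) (ENNReal.ofReal p) (surfaceMeasure N) := by
        refine hmean.trans (add_le_add ?_ ?_)
        · rw [mul_assoc]
          exact lintegral_ball_radialExt_le hφ.continuous hp σ one_half_lt_one.le
        · rw [radialExt_coe] at hosc
          exact hosc.trans_eq (by ring)
    _ ≤ (a + b) * sobolevENorm p φ (sphereGrad φ) := by
        rw [add_mul]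
        gcongr
        · exact le_self_add
        · exact le_add_self

theorem exists_holderBoundedBy_sphere (N : ℕ) {p : ℝ} (hp : 1 ≤ p) (hNp : (N : ℝ) - 1 < p) :
    ∃ C : ℝ≥0, ∀ φ : USphere N → ℝ, SphereSmooth φ →
      HolderBoundedBy (1 - ((N : ℝ) - 1) / p) (C * sobolevENorm p φ (sphereGrad φ)) φ := by
  obtain ⟨C₁, hC₁⟩ := exists_edist_le_of_dist_le_half N hp hNp
  obtain ⟨C₂, hC₂⟩ := exists_enorm_le_sobolevENorm N hp hNp
  have hγ := one_sub_div_pos (by linarith) hNp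
  set γ := 1 - ((N : ℝ) - 1) / p
  set δ := ENNReal.ofReal (1 / 2)
  have hδ : δ ≠ 0 := by simp [δ]
  have hD : (1 + 2 * δ ^ (-γ)) * (C₁ + C₂) ≠ ∞ := by finiteness
  refine ⟨((1 + 2 * δ ^ (-γ)) * (C₁ + C₂)).toNNReal, fun φ hφ => ?_⟩
  rw [ENNReal.coe_toNNReal hD, mul_assoc]
  refine HolderBoundedBy.of_edist_le hγ.le hδ ENNReal.ofReal_ne_top (fun σ => ?_)
    fun σ τ hστ => ?_
  · refine (hC₂ φ hφ σ).trans ?_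
    gcongr
    exact le_add_self
  · refine (hC₁ φ hφ σ τ (edist_le_ofReal (by norm_num) |>.mp hστ)).trans ?_
    gcongr
    · exact le_self_add
    · exact le_add_self

end Morrey

section LpConvergence

variable {α E F H : Type*} [MeasurableSpace α] {μ : Measure α} [NormedAddCommGroup E]
  [NormedAddCommGroup F] [NormedAddCommGroup H] {p q : ℝ≥0∞}

theorem tendsto_eLpNorm_zero_of_dominated (hp0 : p ≠ 0) (hp : p ≠ ∞) {f : ℕ → α → E} {g : α → F}
    (hf : ∀ n, AEStronglyMeasurable (f n) μ) (hg : MemLp g p μ)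
    (hfg : ∀ n, ∀ᵐ x ∂μ, ‖f n x‖ ≤ ‖g x‖)
    (hlim : ∀ᵐ x ∂μ, Tendsto (fun n => f n x) atTop (𝓝 0)) :
    Tendsto (fun n => eLpNorm (f n) p μ) atTop (𝓝 0) := by
  have hp' : 0 < p.toReal := ENNReal.toReal_pos hp0 hp
  simp only [eLpNorm_eq_lintegral_rpow_enorm_toReal hp0 hp]
  have hpow : ∀ {s : ℝ}, 0 < s → ∀ {u : ℕ → ℝ≥0∞}, Tendsto u atTop (𝓝 0) →
      Tendsto (fun n => u n ^ s) atTop (𝓝 0) := fun {s} hs _ hu => by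
    simpa only [ENNReal.zero_rpow_of_pos hs] using hu.ennrpow_const s
  refine hpow (one_div_pos.mpr hp') ?_
  rw [← lintegral_zero (μ := μ)]
  refine tendsto_lintegral_of_dominated_convergence' (fun x => ‖g x‖ₑ ^ p.toReal)
    (fun n => (hf n).enorm.pow_const _) (fun n => ?_)
    (lintegral_rpow_enorm_lt_top_of_eLpNorm_lt_top hp0 hp hg.2).ne ?_
  · filter_upwards [hfg n] with x hx
    exact ENNReal.rpow_le_rpow (enorm_le_iff_norm_le.mpr hx) hp'.le
  · filter_upwards [hlim] with x hx
    exact hpow hp' (by simpa only [enorm_zero] using hx.enorm)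

theorem tendsto_eLpNorm_smul_sub_smul [NormedSpace ℝ E] (hp1 : 1 ≤ p) (hp : p ≠ ∞) {L : ℝ≥0}
    {a : ℕ → α → ℝ} {b : α → ℝ} {f : ℕ → α → E} {g : α → E}
    (ha : ∀ n, AEStronglyMeasurable (a n) μ) (hb : AEStronglyMeasurable b μ)
    (hf : ∀ n, AEStronglyMeasurable (f n) μ) (hg : MemLp g p μ)
    (haL : ∀ n x, ‖a n x‖ ≤ L) (hbL : ∀ x, ‖b x‖ ≤ L)
    (hab : ∀ᵐ x ∂μ, Tendsto (fun n => a n x) atTop (𝓝 (b x)))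
    (hfg : Tendsto (fun n => eLpNorm (f n - g) p μ) atTop (𝓝 0)) :
    Tendsto (fun n => eLpNorm (a n • f n - b • g) p μ) atTop (𝓝 0) := by
  have hscalar : Tendsto (fun n => eLpNorm ((a n - b) • g) p μ) atTop (𝓝 0) := by
    refine tendsto_eLpNorm_zero_of_dominated (one_pos.trans_le hp1).ne' hp
      (fun n => ((ha n).sub hb).smul hg.1) (hg.const_smul (2 * L : ℝ))
      (fun n => ae_of_all _ fun x => ?_) ?_
    · rw [Pi.smul_apply', Pi.smul_apply, norm_smul, norm_smul, Pi.sub_apply,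
        Real.norm_of_nonneg (by positivity : (0 : ℝ) ≤ 2 * L), two_mul]
      gcongr
      exact (norm_sub_le _ _).trans (add_le_add (haL n x) (hbL x))
    · filter_upwards [hab] with x hx
      simpa using (hx.sub_const (b x)).smul_const (g x)
  have hfield : Tendsto (fun n => L * eLpNorm (f n - g) p μ) atTop (𝓝 0) := by
    simpa using ENNReal.Tendsto.const_mul hfg (.inr ENNReal.coe_ne_top)
  refine tendsto_of_tendsto_of_tendsto_of_le_of_le tendsto_const_nhds
    (by simpa using hfield.add hscalar) (fun _ => zero_le) fun n => ?_
  have hsplit : a n • f n - b • g = a n • (f n - g) + (a n - b) • g := by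
    rw [smul_sub, sub_smul]
    abel
  have hbound := eLpNorm_le_nnreal_smul_eLpNorm_of_ae_le_mul (c := L) (f := a n • (f n - g))
    (g := f n - g) (ae_of_all μ fun x => by
      rw [Pi.smul_apply', nnnorm_smul]
      gcongr
      exact haL n x) p
  rw [ENNReal.smul_def, smul_eq_mul] at hbound
  rw [hsplit]
  exact (eLpNorm_add_le ((ha n).smul ((hf n).sub hg.1)) (((ha n).sub hb).smul hg.1) hp1).trans
    (add_le_add_left hbound _)

theorem tendsto_eLpNorm_of_tendsto_sub [Fact (1 ≤ p)] {f : ℕ → α → E} {g : α → E}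
    (hf : ∀ n, MemLp (f n) p μ) (hg : MemLp g p μ)
    (hfg : Tendsto (fun n => eLpNorm (f n - g) p μ) atTop (𝓝 0)) :
    Tendsto (fun n => eLpNorm (f n) p μ) atTop (𝓝 (eLpNorm g p μ)) := by
  simpa only [Lp.enorm_toLp] using ((Lp.tendsto_Lp_iff_tendsto_eLpNorm'' f hf g hg).mpr hfg).enorm

variable [NormedSpace ℝ E] [NormedSpace ℝ F] [NormedSpace ℝ H] [CompleteSpace H]

theorem tendsto_integral_bilin_of_tendsto_eLpNorm [ENNReal.HolderConjugate p q] [Fact (1 ≤ p)]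
    [Fact (1 ≤ q)] (B : E →L[ℝ] F →L[ℝ] H) {X : α → E} {f : ℕ → α → F} {g : α → F}
    (hX : MemLp X p μ) (hf : ∀ n, MemLp (f n) q μ) (hg : MemLp g q μ)
    (hfg : Tendsto (fun n => eLpNorm (f n - g) q μ) atTop (𝓝 0)) :
    Tendsto (fun n => ∫ x, B (X x) (f n x) ∂μ) atTop (𝓝 (∫ x, B (X x) (g x) ∂μ)) := by
  have hpair : ∀ {h : α → F} (hh : MemLp h q μ),
      B.lpPairing μ p q (hX.toLp X) (hh.toLp h) = ∫ x, B (X x) (h x) ∂μ := fun {h} hh => by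
    rw [B.lpPairing_eq_integral]
    refine integral_congr_ae ?_
    filter_upwards [hX.coeFn_toLp, hh.coeFn_toLp] with x h₁ h₂
    rw [h₁, h₂]
  simpa only [Function.comp_def, hpair] using
    ((B.lpPairing μ p q (hX.toLp X)).continuous.tendsto _).comp
      ((Lp.tendsto_Lp_iff_tendsto_eLpNorm'' f hf g hg).mpr hfg)

end LpConvergence

section W0Gradient

variable {N : ℕ} {p : ℝ} {S : Set (USphere N)} {ω : USphere N → ℝ}
  {G : USphere N → EuclideanSpace ℝ (Fin N)}

theorem SphereSmooth.memLp {φ : USphere N → ℝ} (hφ : SphereSmooth φ) (q : ℝ≥0∞)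
    (μ : Measure (USphere N)) [IsFiniteMeasure μ] : MemLp φ q μ :=
  hφ.continuous.memLp_of_hasCompactSupport (HasCompactSupport.of_compactSpace _)

theorem SphereSmooth.memLp_sphereGrad {φ : USphere N → ℝ} (hφ : SphereSmooth φ) (q : ℝ≥0∞)
    (μ : Measure (USphere N)) [IsFiniteMeasure μ] : MemLp (sphereGrad φ) q μ :=
  hφ.continuous_sphereGrad.memLp_of_hasCompactSupport (HasCompactSupport.of_compactSpace _)

theorem HasW0Gradient.exists_seq_ae_tendsto (hp : 0 < p) (h : HasW0Gradient p S ω G) :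
    ∃ φ : ℕ → USphere N → ℝ, (∀ n, IsTestFunction S (φ n)) ∧
      Tendsto (fun n => eLpNorm (φ n - ω) (ENNReal.ofReal p) ((surfaceMeasure N).restrict S))
        atTop (𝓝 0) ∧
      Tendsto (fun n => eLpNorm (sphereGrad (φ n) - G) (ENNReal.ofReal p)
        ((surfaceMeasure N).restrict S)) atTop (𝓝 0) ∧
      ∀ᵐ σ ∂(surfaceMeasure N).restrict S, Tendsto (fun n => φ n σ) atTop (𝓝 (ω σ)) := by
  obtain ⟨φ, hφ, hlim, hlimG⟩ := h.approx
  obtain ⟨k, hk, hae⟩ := (tendstoInMeasure_of_tendsto_eLpNorm (by simpa using hp)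
    (fun n => (hφ n).1.continuous.aestronglyMeasurable) h.memLp.1 hlim).exists_seq_tendsto_ae
  exact ⟨fun n => φ (k n), fun n => hφ _, hlim.comp hk.tendsto_atTop,
    hlimG.comp hk.tendsto_atTop, hae⟩

theorem HasW0Gradient.comp (hp : 1 ≤ p) (h : HasW0Gradient p S ω G) {W : ℝ → ℝ}
    (hW : ContDiff ℝ (⊤ : ℕ∞) W) {L : ℝ≥0} (hL : LipschitzWith L W)
    (hWS : ∀ φ, IsTestFunction S φ → IsTestFunction S (W ∘ φ)) :
    HasW0Gradient p S (W ∘ ω) (fun σ => deriv W (ω σ) • G σ) := by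
  obtain ⟨φ, hφ, hlim, hlimG, hae⟩ := h.exists_seq_ae_tendsto (by linarith)
  have hW' : Continuous (deriv W) := hW.continuous_deriv (by simp)
  have hbound : ∀ t, ‖deriv W t‖ ≤ L := fun t => norm_deriv_le_of_lipschitz hL
  have hω' := hW'.comp_aestronglyMeasurable h.memLp.1
  refine ⟨?_, ?_, fun n => W ∘ φ n, fun n => hWS _ (hφ n), ?_, ?_⟩
  · have hsub : LipschitzWith L fun t => W t - W 0 := fun s t => by
      simpa only [edist_sub_right] using hL s t
    exact ((hsub.comp_memLp (sub_self _) h.memLp).add (memLp_const (W 0))).ae_eq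
      (ae_of_all _ fun σ => by simp)
  · refine h.memLp_grad.of_le_mul (c := L) (hω'.smul h.memLp_grad.1) (ae_of_all _ fun σ => ?_)
    rw [norm_smul]
    gcongr
    exact hbound _
  · have hz : Tendsto (fun n => L * eLpNorm (φ n - ω) (ENNReal.ofReal p)
        ((surfaceMeasure N).restrict S)) atTop (𝓝 0) := by
      simpa using ENNReal.Tendsto.const_mul hlim (.inr ENNReal.coe_ne_top)
    refine tendsto_of_tendsto_of_tendsto_of_le_of_le tendsto_const_nhds hz (fun _ => zero_le)
      fun n => ?_
    exact eLpNorm_le_nnreal_smul_eLpNorm_of_ae_le_mul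
      (ae_of_all _ fun σ => hL.norm_sub_le (φ n σ) (ω σ)) _
  · simp only [fun n => funext (β := fun _ => EuclideanSpace ℝ (Fin N)) fun σ =>
      (hφ n).1.sphereGrad_comp (hW.differentiable (by simp)) (σ := σ)]
    refine tendsto_eLpNorm_smul_sub_smul (by simpa using hp) ENNReal.ofReal_ne_top
      (fun n => (hW'.comp (hφ n).1.continuous).aestronglyMeasurable) hω'
      (fun n => (hφ n).1.continuous_sphereGrad.aestronglyMeasurable) h.memLp_grad
      (fun n σ => hbound (φ n σ)) (fun σ => hbound (ω σ)) ?_ hlimG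
    filter_upwards [hae] with σ hσ using (hW'.tendsto _).comp hσ

theorem HasW0Gradient.comp_of_map_zero (hp : 1 ≤ p) (h : HasW0Gradient p S ω G) {W : ℝ → ℝ}
    (hW : ContDiff ℝ (⊤ : ℕ∞) W) {L : ℝ≥0} (hL : LipschitzWith L W) (hW0 : W 0 = 0) :
    HasW0Gradient p S (W ∘ ω) (fun σ => deriv W (ω σ) • G σ) :=
  h.comp hp hW hL fun _ hφ => hφ.comp hW hW0

theorem isTestFunction_univ {φ : USphere N → ℝ} :
    IsTestFunction Set.univ φ ↔ SphereSmooth φ := by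
  simp [IsTestFunction]

theorem HasW0Gradient.comp_univ (hp : 1 ≤ p) (h : HasW0Gradient p Set.univ ω G) {W : ℝ → ℝ}
    (hW : ContDiff ℝ (⊤ : ℕ∞) W) {L : ℝ≥0} (hL : LipschitzWith L W) :
    HasW0Gradient p Set.univ (W ∘ ω) (fun σ => deriv W (ω σ) • G σ) :=
  h.comp hp hW hL fun _ hφ => isTestFunction_univ.mpr ((isTestFunction_univ.mp hφ).comp hW)

theorem eLpNorm_sub_indicator {E : Type*} [NormedAddCommGroup E] {f g : USphere N → E}
    (hS : MeasurableSet S) (hf : Function.support f ⊆ S) (q : ℝ≥0∞) (μ : Measure (USphere N)) :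
    eLpNorm (f - S.indicator g) q μ = eLpNorm (f - g) q (μ.restrict S) := by
  rw [← eLpNorm_indicator_eq_eLpNorm_restrict hS, Set.indicator_sub', Set.indicator_eq_self.mpr hf]

theorem IsTestFunction.support_sphereGrad_subset {φ : USphere N → ℝ} (hφ : IsTestFunction S φ) :
    Function.support (sphereGrad φ) ⊆ S := fun _ hσ => hφ.2 <| by
  by_contra h
  exact hσ (sphereGrad_eq_zero_of_notMem_tsupport h)

theorem HasW0Gradient.indicator (hS : MeasurableSet S) (h : HasW0Gradient p S ω G) :
    HasW0Gradient p Set.univ (S.indicator ω) (S.indicator G) := by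
  obtain ⟨φ, hφ, hlim, hlimG⟩ := h.approx
  refine ⟨?_, ?_, φ, fun n => isTestFunction_univ.mpr (hφ n).1, ?_, ?_⟩ <;>
    rw [Measure.restrict_univ]
  · exact (memLp_indicator_iff_restrict hS).mpr h.memLp
  · exact (memLp_indicator_iff_restrict hS).mpr h.memLp_grad
  · exact hlim.congr fun n =>
      (eLpNorm_sub_indicator hS ((subset_tsupport _).trans (hφ n).2) _ _).symm
  · exact hlimG.congr fun n =>
      (eLpNorm_sub_indicator hS (hφ n).support_sphereGrad_subset _ _).symm

theorem HasW0Gradient.exists_seq_tendsto_sobolevENorm (hp : 1 ≤ p)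
    (h : HasW0Gradient p Set.univ ω G) :
    ∃ φ : ℕ → USphere N → ℝ, (∀ n, SphereSmooth (φ n)) ∧
      Tendsto (fun n => sobolevENorm p (φ n) (sphereGrad (φ n))) atTop (𝓝 (sobolevENorm p ω G)) ∧
      ∀ᵐ σ ∂surfaceMeasure N, Tendsto (fun n => φ n σ) atTop (𝓝 (ω σ)) := by
  have : Fact (1 ≤ ENNReal.ofReal p) := ⟨by simpa using hp⟩
  obtain ⟨φ, hφ, hlim, hlimG, hae⟩ := h.exists_seq_ae_tendsto (by linarith)
  have hω := h.memLp
  have hG := h.memLp_grad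
  rw [Measure.restrict_univ] at hω hG hae
  simp only [Measure.restrict_univ] at hlim hlimG
  exact ⟨φ, fun n => (hφ n).1,
    (tendsto_eLpNorm_of_tendsto_sub (fun n => (hφ n).1.memLp _ _) hω hlim).add
      (tendsto_eLpNorm_of_tendsto_sub (fun n => (hφ n).1.memLp_sphereGrad _ _) hG hlimG), hae⟩

theorem HasW0Gradient.eLpNorm_le_of_sphereSobolev (hp : 1 ≤ p) (h : HasW0Gradient p Set.univ ω G)
    {q : ℝ} {C : ℝ≥0} (hC : SphereSobolev N p q C) :
    eLpNorm ω (ENNReal.ofReal q) (surfaceMeasure N) ≤ C * sobolevENorm p ω G := by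
  obtain ⟨φ, hφ, hnorm, hae⟩ := h.exists_seq_tendsto_sobolevENorm hp
  have hlim := ENNReal.Tendsto.const_mul hnorm (.inr (ENNReal.coe_ne_top (r := C)))
  refine (Lp.eLpNorm_lim_le_liminf_eLpNorm
    (fun n => (hφ n).continuous.aestronglyMeasurable) ω hae).trans ?_
  rw [← hlim.liminf_eq]
  exact liminf_le_liminf (Eventually.of_forall fun n => hC _ (hφ n))

end W0Gradient

section FluxEstimates

variable {p β Λ : ℝ}

theorem rpow_sub_two_half_mul_self {a : ℝ} (ha : 0 ≤ a) (hp : 0 < p) :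
    a ^ ((p - 2) / 2) * a = a ^ (p / 2) := by
  rw [← Real.rpow_add_one' ha (by linarith)]
  ring_nf

theorem sq_rpow_half {x : ℝ} (hx : 0 ≤ x) (p : ℝ) : (x ^ 2) ^ (p / 2) = x ^ p := by
  rw [← Real.rpow_natCast_mul hx]
  congr 1
  push_cast
  ring

theorem sq_rpow_mul_sq (hp : 0 < p) (w : ℝ) : (w ^ 2) ^ ((p - 2) / 2) * w ^ 2 = ‖w‖ ^ p := by
  rw [rpow_sub_two_half_mul_self (sq_nonneg w) hp, ← sq_abs, sq_rpow_half (abs_nonneg w),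
    Real.norm_eq_abs]

theorem rpow_mul_le_rpow_of_sq_le {a x : ℝ} (h : x ^ 2 ≤ a) (p : ℝ) :
    a ^ ((p - 2) / 2) * x ≤ a ^ ((p - 1) / 2) := by
  have ha : 0 ≤ a := (sq_nonneg x).trans h
  rcases ha.eq_or_lt with rfl | ha'
  · rw [pow_eq_zero_iff two_ne_zero |>.mp (h.antisymm (sq_nonneg x)), mul_zero]
    positivity
  · calc a ^ ((p - 2) / 2) * x ≤ a ^ ((p - 2) / 2) * a ^ ((1 : ℝ) / 2) := by
          gcongr
          rw [← Real.sqrt_eq_rpow]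
          exact Real.le_sqrt_of_sq_le h
      _ = a ^ ((p - 1) / 2) := by
          rw [← Real.rpow_add ha']
          ring_nf

theorem exists_mul_rpow_mul_sq_le_of_two_le (hp : 2 ≤ p) (hΛ : 0 ≤ Λ) :
    ∃ C : ℝ, 0 ≤ C ∧ ∀ w a : ℝ, 0 ≤ a →
      Λ * (a ^ ((p - 2) / 2) * w ^ 2) ≤ 1 / 2 * a ^ (p / 2) + C * ‖w‖ ^ p := by
  set k := 2 * (Λ + 1)
  have hp0 : 0 < p := by linarith
  have hk : 0 < k := by positivity
  refine ⟨Λ * k ^ ((p - 2) / 2), by positivity, fun w a ha => ?_⟩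
  rcases le_or_gt (k * w ^ 2) a with h | h
  · have hsmall : Λ * w ^ 2 ≤ 1 / 2 * a := by nlinarith [sq_nonneg w]
    calc Λ * (a ^ ((p - 2) / 2) * w ^ 2) = a ^ ((p - 2) / 2) * (Λ * w ^ 2) := by ring
      _ ≤ a ^ ((p - 2) / 2) * (1 / 2 * a) := by gcongr
      _ = 1 / 2 * a ^ (p / 2) := by rw [← rpow_sub_two_half_mul_self ha hp0]; ring
      _ ≤ _ := le_add_of_nonneg_right (by positivity)
  · calc Λ * (a ^ ((p - 2) / 2) * w ^ 2)
        ≤ Λ * ((k * w ^ 2) ^ ((p - 2) / 2) * w ^ 2) := by gcongr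
      _ = Λ * k ^ ((p - 2) / 2) * ((w ^ 2) ^ ((p - 2) / 2) * w ^ 2) := by
          rw [Real.mul_rpow hk.le (sq_nonneg w)]; ring
      _ = Λ * k ^ ((p - 2) / 2) * ‖w‖ ^ p := by rw [sq_rpow_mul_sq hp0]
      _ ≤ _ := le_add_of_nonneg_left (by positivity)

theorem mul_rpow_mul_sq_le_of_le_two (hp0 : 0 < p) (hp : p ≤ 2) (hΛ : 0 ≤ Λ) (hβ : β ≠ 0) {w a : ℝ}
    (hwa : β ^ 2 * w ^ 2 ≤ a) :
    Λ * (a ^ ((p - 2) / 2) * w ^ 2) ≤ Λ * (β ^ 2) ^ ((p - 2) / 2) * ‖w‖ ^ p := by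
  rcases eq_or_ne w 0 with rfl | hw
  · simp [Real.zero_rpow hp0.ne']
  calc Λ * (a ^ ((p - 2) / 2) * w ^ 2)
      ≤ Λ * ((β ^ 2 * w ^ 2) ^ ((p - 2) / 2) * w ^ 2) := by
        gcongr ?_ * (?_ * ?_)
        exact Real.rpow_le_rpow_of_nonpos (by positivity) hwa (by linarith)
    _ = Λ * (β ^ 2) ^ ((p - 2) / 2) * ((w ^ 2) ^ ((p - 2) / 2) * w ^ 2) := by
        rw [Real.mul_rpow (sq_nonneg β) (sq_nonneg w)]; ring
    _ = Λ * (β ^ 2) ^ ((p - 2) / 2) * ‖w‖ ^ p := by rw [sq_rpow_mul_sq hp0]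

theorem exists_mul_rpow_mul_sq_le (hp : 0 < p) (hΛ : 0 ≤ Λ) (hβ : β = 0 → Λ = 0) :
    ∃ C : ℝ, 0 ≤ C ∧ ∀ w a : ℝ, β ^ 2 * w ^ 2 ≤ a →
      Λ * (a ^ ((p - 2) / 2) * w ^ 2) ≤ 1 / 2 * a ^ (p / 2) + C * ‖w‖ ^ p := by
  rcases le_or_gt 2 p with h2 | h2
  · obtain ⟨C, hC0, hC⟩ := exists_mul_rpow_mul_sq_le_of_two_le h2 hΛ
    exact ⟨C, hC0, fun w a hwa => hC w a (le_trans (by positivity) hwa)⟩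
  · refine ⟨Λ * (β ^ 2) ^ ((p - 2) / 2), by positivity, fun w a hwa => ?_⟩
    have ha : 0 ≤ a := le_trans (by positivity) hwa
    refine le_trans ?_ (le_add_of_nonneg_left (by positivity))
    by_cases hβ0 : β = 0
    · simp [hβ hβ0]
    · exact mul_rpow_mul_sq_le_of_le_two hp h2.le hΛ hβ0 hwa

end FluxEstimates

section EnergyDensity

variable {α E : Type*} [NormedAddCommGroup E] {p β lam C : ℝ}

/-- The density `β² w² + |g|²` of the equation at a point where the solution has value `w` and
gradient `g`. -/
def energyDensity (β w : ℝ) (g : E) : ℝ := β ^ 2 * w ^ 2 + ‖g‖ ^ 2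

theorem energyDensity_nonneg (β w : ℝ) (g : E) : 0 ≤ energyDensity β w g := by
  unfold energyDensity
  positivity

theorem sq_norm_le_energyDensity (β w : ℝ) (g : E) : ‖g‖ ^ 2 ≤ energyDensity β w g :=
  le_add_of_nonneg_left (by positivity)

theorem mul_sq_le_energyDensity (β w : ℝ) (g : E) : β ^ 2 * w ^ 2 ≤ energyDensity β w g :=
  le_add_of_nonneg_right (sq_nonneg _)

theorem norm_rpow_mul_le_of_absorption [InnerProductSpace ℝ E] {w d f : ℝ} {g : E} (hp : 0 < p)
    (hd : 0 ≤ d) (hf : |w * f| ≤ w ^ 2 * d)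
    (habs : (|lam| + β ^ 2) * (energyDensity β w g ^ ((p - 2) / 2) * w ^ 2) ≤
      1 / 2 * energyDensity β w g ^ (p / 2) + C * ‖w‖ ^ p) :
    ‖g‖ ^ p * d ≤ 2 * (inner ℝ (energyDensity β w g ^ ((p - 2) / 2) • g) (d • g) -
      lam * (energyDensity β w g ^ ((p - 2) / 2) * w) * f + C * (‖w‖ ^ p * d)) := by
  set A := energyDensity β w g
  set e := A ^ ((p - 2) / 2)
  have hA0 : 0 ≤ A := energyDensity_nonneg β w g
  have : 0 ≤ e := Real.rpow_nonneg hA0 _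
  have hgrad : ‖g‖ ^ p ≤ A ^ (p / 2) := by
    rw [← sq_rpow_half (norm_nonneg g)]
    exact Real.rpow_le_rpow (sq_nonneg _) (sq_norm_le_energyDensity β w g) (by positivity)
  have henergy : A ^ (p / 2) = e * (β ^ 2 * w ^ 2 + ‖g‖ ^ 2) :=
    (rpow_sub_two_half_mul_self hA0 hp).symm
  have hflux : inner ℝ (e • g) (d • g) = d * (A ^ (p / 2) - β ^ 2 * (e * w ^ 2)) := by
    rw [real_inner_smul_left, real_inner_smul_right, real_inner_self_eq_norm_sq, henergy]
    ring
  have hzero : lam * (e * w) * f ≤ d * (|lam| * (e * w ^ 2)) :=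
    calc lam * (e * w) * f = e * (lam * (w * f)) := by ring
      _ ≤ e * (|lam| * (w ^ 2 * d)) := by
          gcongr e * ?_
          calc lam * (w * f) ≤ |lam| * |w * f| := (le_abs_self _).trans_eq (abs_mul _ _)
            _ ≤ |lam| * (w ^ 2 * d) := by gcongr
      _ = d * (|lam| * (e * w ^ 2)) := by ring
  rw [hflux]
  nlinarith [mul_le_mul_of_nonneg_left habs hd, mul_le_mul_of_nonneg_left hgrad hd]

variable [MeasurableSpace α] {μ : Measure α} {ω : α → ℝ} {G : α → E}

theorem memLp_sqrt_energyDensity (β : ℝ) {q : ℝ≥0∞} (hω : MemLp ω q μ) (hG : MemLp G q μ) :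
    MemLp (fun x => √(energyDensity β (ω x) (G x))) q μ := by
  refine ((hω.norm.const_mul |β|).add hG.norm).mono ?_ (ae_of_all _ fun x => ?_)
  · exact Real.continuous_sqrt.comp_aestronglyMeasurable
      (((hω.1.pow 2).const_mul _).add (hG.1.norm.pow 2))
  · rw [Real.norm_of_nonneg (Real.sqrt_nonneg _), Pi.add_apply,
      Real.norm_of_nonneg (by positivity), ← Real.norm_eq_abs, ← norm_mul]
    refine Real.sqrt_le_iff.mpr ⟨by positivity, ?_⟩
    rw [energyDensity, ← mul_pow, ← sq_abs (β * ω x), ← Real.norm_eq_abs]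
    nlinarith [mul_nonneg (norm_nonneg (β * ω x)) (norm_nonneg (G x))]

theorem memLp_rpow_smul_of_sq_le {F : Type*} [NormedAddCommGroup F] [NormedSpace ℝ F] (hp : 1 < p)
    {a : α → ℝ} {v : α → F} (ha : MemLp (fun x => √(a x)) (ENNReal.ofReal p) μ)
    (hv : AEStronglyMeasurable v μ) (hva : ∀ x, ‖v x‖ ^ 2 ≤ a x) :
    MemLp (fun x => a x ^ ((p - 2) / 2) • v x) (ENNReal.ofReal (p / (p - 1))) μ := by
  have hp1 : 0 < p - 1 := by linarith
  have ha0 : ∀ x, 0 ≤ a x := fun x => (sq_nonneg _).trans (hva x)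
  have hsqrt : ∀ x (s : ℝ), √(a x) ^ (2 * s) = a x ^ s := fun x s => by
    rw [Real.rpow_mul (Real.sqrt_nonneg _), Real.rpow_two, Real.sq_sqrt (ha0 x)]
  have hpow := ha.norm_rpow_div (ENNReal.ofReal (p - 1))
  rw [← ENNReal.ofReal_div_of_pos hp1, ENNReal.toReal_ofReal hp1.le] at hpow
  have hmeas : AEStronglyMeasurable (fun x => a x ^ ((p - 2) / 2)) μ := by
    simp only [← hsqrt]
    exact (ha.1.aemeasurable.pow_const _).aestronglyMeasurable
  refine hpow.mono (hmeas.smul hv) (ae_of_all _ fun x => ?_)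
  have hexp : ‖√(a x)‖ ^ (p - 1) = a x ^ ((p - 1) / 2) := by
    rw [Real.norm_of_nonneg (Real.sqrt_nonneg _), ← hsqrt, mul_div_cancel₀ _ two_ne_zero]
  have hpos : ∀ s : ℝ, 0 ≤ a x ^ s := fun s => Real.rpow_nonneg (ha0 x) s
  rw [norm_smul, hexp, Real.norm_of_nonneg (hpos _), Real.norm_of_nonneg (hpos _)]
  exact rpow_mul_le_rpow_of_sq_le (hva x) p

theorem memLp_energyDensity_rpow_smul_grad [NormedSpace ℝ E] (hp : 1 < p) (β : ℝ)
    (hω : MemLp ω (ENNReal.ofReal p) μ) (hG : MemLp G (ENNReal.ofReal p) μ) :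
    MemLp (fun x => energyDensity β (ω x) (G x) ^ ((p - 2) / 2) • G x)
      (ENNReal.ofReal (p / (p - 1))) μ :=
  memLp_rpow_smul_of_sq_le hp (memLp_sqrt_energyDensity β hω hG) hG.1
    fun x => sq_norm_le_energyDensity β (ω x) (G x)

theorem memLp_mul_energyDensity_rpow_mul (hp : 1 < p) (hlam : β = 0 → lam = 0)
    (hω : MemLp ω (ENNReal.ofReal p) μ) (hG : MemLp G (ENNReal.ofReal p) μ) :
    MemLp (fun x => lam * (energyDensity β (ω x) (G x) ^ ((p - 2) / 2) * ω x))
      (ENNReal.ofReal (p / (p - 1))) μ := by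
  refine ((memLp_rpow_smul_of_sq_le hp (memLp_sqrt_energyDensity β hω hG) (hω.1.const_mul β)
    fun x => ?_).const_mul (lam / β)).ae_eq (ae_of_all _ fun x => ?_)
  · rw [Real.norm_eq_abs, sq_abs, mul_pow]
    exact mul_sq_le_energyDensity β (ω x) (G x)
  · rw [smul_eq_mul, mul_left_comm _ β, ← mul_assoc, div_mul_cancel_of_imp hlam]

end EnergyDensity

section WeightedEnergy

variable {α E : Type*} [MeasurableSpace α] {μ : Measure α} [NormedAddCommGroup E] {p : ℝ}
  {C : ℝ≥0} {ω : α → ℝ} {G : α → E}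

/-- The functions `F` for which `F ∘ ω` is used as a test function. The last condition compares
`F` with its linearisation and is what makes the zero-order term of the tested equation
controllable by the weight `F'`. -/
structure IsAdmissibleTest (F : ℝ → ℝ) : Prop where
  contDiff : ContDiff ℝ (⊤ : ℕ∞) F
  map_zero : F 0 = 0
  deriv_nonneg : ∀ t, 0 ≤ deriv F t
  lipschitz : ∃ L, LipschitzWith L F
  abs_mul_le : ∀ t, |t * F t| ≤ t ^ 2 * deriv F t

theorem isAdmissibleTest_id : IsAdmissibleTest id where
  contDiff := contDiff_id
  map_zero := rfl
  deriv_nonneg t := by simp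
  lipschitz := ⟨1, LipschitzWith.id⟩
  abs_mul_le t := by simp [sq]

/-- The energy estimates `∫ |G|^p F'(ω) ≤ C ∫ |ω|^p F'(ω)` obtained by testing with `F ∘ ω`. -/
def WeightedEnergyBound (μ : Measure α) (p : ℝ) (C : ℝ≥0) (ω : α → ℝ) (G : α → E) : Prop :=
  ∀ F, IsAdmissibleTest F →
    ∫⁻ x, ‖G x‖ₑ ^ p * ENNReal.ofReal (deriv F (ω x)) ∂μ ≤
      C * ∫⁻ x, ‖ω x‖ₑ ^ p * ENNReal.ofReal (deriv F (ω x)) ∂μ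

theorem lintegral_enorm_indicator_rpow_mul (hp : 0 < p) {S : Set α} (hS : MeasurableSet S)
    (f : α → E) (D : ℝ → ℝ≥0∞) (ω : α → ℝ) :
    ∫⁻ x, ‖S.indicator f x‖ₑ ^ p * D (S.indicator ω x) ∂μ =
      ∫⁻ x in S, ‖f x‖ₑ ^ p * D (ω x) ∂μ := by
  rw [← lintegral_indicator hS]
  refine lintegral_congr fun x => ?_
  by_cases hx : x ∈ S <;> simp [hx, hp]

theorem WeightedEnergyBound.indicator {S : Set α} (hS : MeasurableSet S) (hp : 0 < p)
    (h : WeightedEnergyBound (μ.restrict S) p C ω G) :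
    WeightedEnergyBound μ p C (S.indicator ω) (S.indicator G) := by
  intro F hF
  simpa only [lintegral_enorm_indicator_rpow_mul hp hS _ fun t => ENNReal.ofReal (deriv F t)]
    using h F hF

theorem WeightedEnergyBound.eLpNorm_grad_le (hp : 0 < p) (h : WeightedEnergyBound μ p C ω G) :
    eLpNorm G (ENNReal.ofReal p) μ ≤
      (C : ℝ≥0∞) ^ (1 / p) * eLpNorm ω (ENNReal.ofReal p) μ := by
  have hid := h id isAdmissibleTest_id
  simp only [deriv_id, ENNReal.ofReal_one, mul_one] at hid
  rw [eLpNorm_eq_lintegral_rpow_enorm_toReal (by simpa using hp) ENNReal.ofReal_ne_top,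
    eLpNorm_eq_lintegral_rpow_enorm_toReal (by simpa using hp) ENNReal.ofReal_ne_top,
    ENNReal.toReal_ofReal hp.le, ← ENNReal.mul_rpow_of_nonneg _ _ (by positivity)]
  gcongr

theorem integral_le_of_le_two_mul {f X Y m : α → ℝ} {C : ℝ} (hf : Integrable f μ)
    (hX : Integrable X μ) (hY : Integrable Y μ) (hm : Integrable m μ)
    (hXY : ∫ x, X x ∂μ = ∫ x, Y x ∂μ) (h : ∀ x, f x ≤ 2 * (X x - Y x + C * m x)) :
    ∫ x, f x ∂μ ≤ 2 * C * ∫ x, m x ∂μ := by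
  refine (integral_mono hf (((hX.sub hY).add (hm.const_mul C)).const_mul 2) h).trans_eq ?_
  rw [integral_const_mul, integral_add' (hX.sub hY) (hm.const_mul C), integral_sub' hX hY,
    integral_const_mul, hXY, sub_self, zero_add, mul_assoc]

theorem integrable_norm_rpow_mul (hp : 0 < p) {L : ℝ} {f : α → E} {D : α → ℝ}
    (hf : MemLp f (ENNReal.ofReal p) μ) (hD : AEStronglyMeasurable D μ) (hDL : ∀ x, ‖D x‖ ≤ L) :
    Integrable (fun x => ‖f x‖ ^ p * D x) μ := by
  have hint := hf.integrable_norm_rpow (by simpa using hp) ENNReal.ofReal_ne_top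
  rw [ENNReal.toReal_ofReal hp.le] at hint
  exact hint.mul_bdd hD (ae_of_all _ hDL)

theorem lintegral_enorm_rpow_mul_ofReal (hp : 0 ≤ p) {f : α → E} {D : α → ℝ}
    (hint : Integrable (fun x => ‖f x‖ ^ p * D x) μ) (hD : ∀ x, 0 ≤ D x) :
    ∫⁻ x, ‖f x‖ₑ ^ p * ENNReal.ofReal (D x) ∂μ = ENNReal.ofReal (∫ x, ‖f x‖ ^ p * D x ∂μ) := by
  rw [ofReal_integral_eq_lintegral_ofReal hint
    (ae_of_all _ fun x => mul_nonneg (by positivity) (hD x))]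
  refine lintegral_congr fun x => ?_
  rw [ENNReal.ofReal_mul (by positivity), ← ENNReal.ofReal_rpow_of_nonneg (norm_nonneg _) hp,
    ofReal_norm]

end WeightedEnergy

section WeakSolutions

variable {N : ℕ} {p β lam : ℝ} {S : Set (USphere N)} {ω : USphere N → ℝ}
  {G : USphere N → EuclideanSpace ℝ (Fin N)}

/-- `-div' ((β² ω² + |G|²)^{(p-2)/2} G) = lam (β² ω² + |G|²)^{(p-2)/2} ω` in `S` in the weak
sense, with an arbitrary factor `lam` in place of `(p-1) β (β-β₀)`. -/
def IsWeakSolution (p β lam : ℝ) (S : Set (USphere N)) (ω : USphere N → ℝ)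
    (G : USphere N → EuclideanSpace ℝ (Fin N)) : Prop :=
  ∀ φ : USphere N → ℝ, IsTestFunction S φ →
    ∫ σ in S, energyDensity β (ω σ) (G σ) ^ ((p - 2) / 2) * inner ℝ (G σ) (sphereGrad φ σ)
        ∂surfaceMeasure N =
      lam * ∫ σ in S, energyDensity β (ω σ) (G σ) ^ ((p - 2) / 2) * ω σ * φ σ ∂surfaceMeasure N

theorem IsWeakSolution.integral_eq (hp : 1 < p) (hlam : β = 0 → lam = 0)
    (hω : HasW0Gradient p S ω G) (h : IsWeakSolution p β lam S ω G) {ψ : USphere N → ℝ}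
    {H : USphere N → EuclideanSpace ℝ (Fin N)} (hψ : HasW0Gradient p S ψ H) :
    ∫ σ in S, inner ℝ (energyDensity β (ω σ) (G σ) ^ ((p - 2) / 2) • G σ) (H σ)
        ∂surfaceMeasure N =
      ∫ σ in S, lam * (energyDensity β (ω σ) (G σ) ^ ((p - 2) / 2) * ω σ) * ψ σ
        ∂surfaceMeasure N := by
  have : (ENNReal.ofReal (p / (p - 1))).HolderConjugate (ENNReal.ofReal p) :=
    (Real.HolderConjugate.conjExponent hp).symm.ennrealOfReal
  have : Fact (1 ≤ ENNReal.ofReal p) := ⟨by simpa using hp.le⟩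
  have : Fact (1 ≤ ENNReal.ofReal (p / (p - 1))) :=
    ⟨ENNReal.one_le_ofReal.mpr (Real.HolderConjugate.conjExponent hp).symm.lt.le⟩
  obtain ⟨φ, hφ, hlim, hlimG⟩ := hψ.approx
  have hL := tendsto_integral_bilin_of_tendsto_eLpNorm (innerSL ℝ)
    (memLp_energyDensity_rpow_smul_grad hp β hω.memLp hω.memLp_grad)
    (fun n => (hφ n).1.memLp_sphereGrad _ _) hψ.memLp_grad hlimG
  have hR := tendsto_integral_bilin_of_tendsto_eLpNorm (ContinuousLinearMap.mul ℝ ℝ)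
    (memLp_mul_energyDensity_rpow_mul hp hlam hω.memLp hω.memLp_grad)
    (fun n => (hφ n).1.memLp _ _) hψ.memLp hlim
  have htest : ∀ n, ∫ σ in S, inner ℝ (energyDensity β (ω σ) (G σ) ^ ((p - 2) / 2) • G σ)
      (sphereGrad (φ n) σ) ∂surfaceMeasure N =
      ∫ σ in S, lam * (energyDensity β (ω σ) (G σ) ^ ((p - 2) / 2) * ω σ) * φ n σ
        ∂surfaceMeasure N := fun n => by
    simpa only [real_inner_smul_left, mul_assoc, integral_const_mul] using h (φ n) (hφ n)
  exact tendsto_nhds_unique (hL.congr htest) hR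

theorem IsWeakSolution.integral_norm_grad_rpow_mul_deriv_le (hp : 1 < p) (hlam : β = 0 → lam = 0)
    (hω : HasW0Gradient p S ω G) (h : IsWeakSolution p β lam S ω G) {C : ℝ}
    (hC : ∀ w a : ℝ, β ^ 2 * w ^ 2 ≤ a → (|lam| + β ^ 2) * (a ^ ((p - 2) / 2) * w ^ 2) ≤
      1 / 2 * a ^ (p / 2) + C * ‖w‖ ^ p) {F : ℝ → ℝ} (hF : IsAdmissibleTest F) {L : ℝ≥0}
    (hL : LipschitzWith L F) :
    ∫ σ in S, ‖G σ‖ ^ p * deriv F (ω σ) ∂surfaceMeasure N ≤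
      2 * C * ∫ σ in S, ‖ω σ‖ ^ p * deriv F (ω σ) ∂surfaceMeasure N := by
  have hp0 : 0 < p := by linarith
  have : (ENNReal.ofReal (p / (p - 1))).HolderConjugate (ENNReal.ofReal p) :=
    (Real.HolderConjugate.conjExponent hp).symm.ennrealOfReal
  have hD := (hF.contDiff.continuous_deriv (by simp)).comp_aestronglyMeasurable hω.memLp.1
  have hDL : ∀ σ, ‖deriv F (ω σ)‖ ≤ L := fun σ => norm_deriv_le_of_lipschitz hL
  have hFω := hω.comp_of_map_zero hp.le hF.contDiff hL hF.map_zero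
  have hflux := memLp_one_iff_integrable.mp <| (innerSL ℝ).memLp_of_bilin 1
    (memLp_energyDensity_rpow_smul_grad hp β hω.memLp hω.memLp_grad) hFω.memLp_grad
  have hzero := memLp_one_iff_integrable.mp <| (ContinuousLinearMap.mul ℝ ℝ).memLp_of_bilin 1
    (memLp_mul_energyDensity_rpow_mul hp hlam hω.memLp hω.memLp_grad) hFω.memLp
  exact integral_le_of_le_two_mul (integrable_norm_rpow_mul hp0 hω.memLp_grad hD hDL) hflux hzero
    (integrable_norm_rpow_mul hp0 hω.memLp hD hDL) (h.integral_eq hp hlam hω hFω) fun σ =>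
    norm_rpow_mul_le_of_absorption hp0 (hF.deriv_nonneg _) (hF.abs_mul_le _)
      (hC _ _ (mul_sq_le_energyDensity β _ _))

theorem exists_weightedEnergyBound (N : ℕ) (hp : 1 < p) (hlam : β = 0 → lam = 0) :
    ∃ C : ℝ≥0, ∀ (S : Set (USphere N)) (ω : USphere N → ℝ)
      (G : USphere N → EuclideanSpace ℝ (Fin N)), HasW0Gradient p S ω G →
      IsWeakSolution p β lam S ω G →
      WeightedEnergyBound ((surfaceMeasure N).restrict S) p C ω G := by
  have hp0 : 0 < p := by linarith
  obtain ⟨C, hC0, hC⟩ := exists_mul_rpow_mul_sq_le hp0 (β := β) (Λ := |lam| + β ^ 2)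
    (by positivity) (fun h => by simp [h, hlam h])
  refine ⟨(2 * C).toNNReal, fun S ω G hω h F hF => ?_⟩
  obtain ⟨L, hL⟩ := hF.lipschitz
  have hD := (hF.contDiff.continuous_deriv (by simp)).comp_aestronglyMeasurable hω.memLp.1
  have hDL : ∀ σ, ‖deriv F (ω σ)‖ ≤ L := fun σ => norm_deriv_le_of_lipschitz hL
  have hD0 : ∀ σ, 0 ≤ deriv F (ω σ) := fun σ => hF.deriv_nonneg _
  rw [lintegral_enorm_rpow_mul_ofReal hp0.le
      (integrable_norm_rpow_mul hp0 hω.memLp_grad hD hDL) hD0,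
    lintegral_enorm_rpow_mul_ofReal hp0.le (integrable_norm_rpow_mul hp0 hω.memLp hD hDL) hD0,
    ← ENNReal.ofReal, ← ENNReal.ofReal_mul (by positivity)]
  exact ENNReal.ofReal_le_ofReal
    (h.integral_norm_grad_rpow_mul_deriv_le hp hlam hω hC hF hL)

end WeakSolutions

section Truncation

/-- A smooth bounded truncation of `ε + t ^ 2`, which it increases to as `δ → 0`. -/
noncomputable def truncSq (ε δ t : ℝ) : ℝ := ε + t ^ 2 / (1 + δ * t ^ 2)

variable {ε δ : ℝ}

theorem truncSq_pos (hε : 0 < ε) (hδ : 0 < δ) (t : ℝ) : 0 < truncSq ε δ t := by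
  unfold truncSq
  positivity

theorem truncSq_le (hδ : 0 < δ) (t : ℝ) : truncSq ε δ t ≤ ε + t ^ 2 := by
  unfold truncSq
  gcongr
  exact div_le_self (sq_nonneg t) (le_add_of_nonneg_right (by positivity))

theorem truncSq_le_add_one_div (hδ : 0 < δ) (t : ℝ) : truncSq ε δ t ≤ ε + 1 / δ := by
  unfold truncSq
  gcongr ε + ?_
  rw [div_le_div_iff₀ (by positivity) hδ]
  nlinarith

theorem truncSq_le_truncSq (hδ : 0 < δ) {x t : ℝ} (h : |x| ≤ |t|) :
    truncSq ε δ x ≤ truncSq ε δ t := by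
  unfold truncSq
  have hsq : x ^ 2 ≤ t ^ 2 := sq_le_sq.mpr h
  gcongr ε + ?_
  rw [div_le_div_iff₀ (by positivity) (by positivity)]
  nlinarith

theorem contDiff_truncSq_rpow (hε : 0 < ε) (hδ : 0 < δ) (r : ℝ) :
    ContDiff ℝ (⊤ : ℕ∞) fun t => truncSq ε δ t ^ r := by
  have htrunc : ContDiff ℝ (⊤ : ℕ∞) (truncSq ε δ) := by
    unfold truncSq
    exact contDiff_const.add (ContDiff.div (by fun_prop) (by fun_prop) fun t => by positivity)
  exact htrunc.rpow_const_of_ne fun t => (truncSq_pos hε hδ t).ne'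

theorem hasDerivAt_truncSq (hδ : 0 < δ) (t : ℝ) :
    HasDerivAt (truncSq ε δ) (2 * t / (1 + δ * t ^ 2) ^ 2) t := by
  have hnum : HasDerivAt (fun t : ℝ => t ^ 2) (2 * t) t := by simpa using hasDerivAt_pow 2 t
  have hden : 1 + δ * t ^ 2 ≠ 0 := by positivity
  refine ((hnum.div ((hnum.const_mul δ).const_add 1) hden).const_add ε).congr_deriv ?_
  congr 1
  ring

theorem abs_two_mul_div_sq_le_truncSq_rpow (hε : 0 < ε) (hδ : 0 < δ) (t : ℝ) :
    |2 * t / (1 + δ * t ^ 2) ^ 2| ≤ 2 * truncSq ε δ t ^ ((1 : ℝ) / 2) := by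
  rw [← Real.sqrt_eq_rpow, mul_div_assoc, abs_mul, abs_two]
  gcongr
  refine Real.le_sqrt_of_sq_le ?_
  have hden : 1 ≤ 1 + δ * t ^ 2 := le_add_of_nonneg_right (by positivity)
  calc |t / (1 + δ * t ^ 2) ^ 2| ^ 2 = t ^ 2 / (1 + δ * t ^ 2) ^ (2 * 2) := by
        rw [sq_abs, div_pow, pow_mul]
    _ ≤ t ^ 2 / (1 + δ * t ^ 2) := by
        gcongr
        exact le_self_pow₀ hden (by norm_num)
    _ ≤ truncSq ε δ t := le_add_of_nonneg_left hε.le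

theorem abs_deriv_truncSq_rpow_le (hε : 0 < ε) (hδ : 0 < δ) {s : ℝ} (hs : 0 ≤ s) (t : ℝ) :
    |deriv (fun t => truncSq ε δ t ^ (s / 2)) t| ≤ s * truncSq ε δ t ^ ((s - 1) / 2) := by
  have hpos := truncSq_pos hε hδ t
  have hpow : ∀ r : ℝ, 0 ≤ truncSq ε δ t ^ r := Real.rpow_nonneg hpos.le
  have hderiv := (hasDerivAt_truncSq (ε := ε) hδ t).rpow_const (p := s / 2) (.inl hpos.ne')
  rw [hderiv.deriv, abs_mul, abs_mul, abs_of_nonneg (by positivity : 0 ≤ s / 2),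
    abs_of_nonneg (hpow _)]
  calc |2 * t / (1 + δ * t ^ 2) ^ 2| * (s / 2) * truncSq ε δ t ^ (s / 2 - 1)
      ≤ 2 * truncSq ε δ t ^ ((1 : ℝ) / 2) * (s / 2) * truncSq ε δ t ^ (s / 2 - 1) := by
        gcongr
        exact abs_two_mul_div_sq_le_truncSq_rpow hε hδ t
    _ = s * (truncSq ε δ t ^ ((1 : ℝ) / 2) * truncSq ε δ t ^ (s / 2 - 1)) := by ring
    _ = s * truncSq ε δ t ^ ((s - 1) / 2) := by
        rw [← Real.rpow_add hpos]
        ring_nf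

theorem truncSq_rpow_le_add_one_div_rpow (hε : 0 < ε) (hδ : 0 < δ) {r : ℝ} (hr : 0 ≤ r) (t : ℝ) :
    truncSq ε δ t ^ r ≤ (ε + 1 / δ) ^ r :=
  Real.rpow_le_rpow (truncSq_pos hε hδ t).le (truncSq_le_add_one_div hδ t) hr

theorem exists_lipschitzWith_truncSq_rpow (hε : 0 < ε) (hδ : 0 < δ) {s : ℝ} (hs : 1 ≤ s) :
    ∃ L, LipschitzWith L fun t => truncSq ε δ t ^ (s / 2) := by
  have hs0 : 0 ≤ s := by linarith
  refine ⟨(s * (ε + 1 / δ) ^ ((s - 1) / 2)).toNNReal, lipschitzWith_of_nnnorm_deriv_le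
    ((contDiff_truncSq_rpow hε hδ _).differentiable (by simp)) fun t => ?_⟩
  rw [← norm_toNNReal]
  refine Real.toNNReal_le_toNNReal ((abs_deriv_truncSq_rpow_le hε hδ hs0 t).trans ?_)
  gcongr s * ?_
  exact truncSq_rpow_le_add_one_div_rpow hε hδ (by linarith) t

theorem tendsto_truncSq (ε t : ℝ) :
    Tendsto (fun n : ℕ => truncSq ε (1 / ((n : ℝ) + 1)) t) atTop (𝓝 (ε + t ^ 2)) := by
  have hden : Tendsto (fun n : ℕ => 1 + 1 / ((n : ℝ) + 1) * t ^ 2) atTop (𝓝 (1 + 0 * t ^ 2)) :=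
    (tendsto_one_div_add_atTop_nhds_zero_nat.mul_const _).const_add 1
  simpa [truncSq] using
    ((tendsto_const_nhds (x := t ^ 2)).div hden (by norm_num)).const_add ε

/-- The odd primitive of a power of the truncation; its composition with the solution is the test
function of the Moser iteration. -/
noncomputable def truncPrimitive (ε δ r t : ℝ) : ℝ := ∫ x in (0 : ℝ)..t, truncSq ε δ x ^ r

theorem deriv_truncPrimitive (hε : 0 < ε) (hδ : 0 < δ) (r : ℝ) :
    deriv (truncPrimitive ε δ r) = fun t => truncSq ε δ t ^ r :=
  funext fun t => (contDiff_truncSq_rpow hε hδ r).continuous.deriv_integral _ 0 t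

theorem contDiff_truncPrimitive (hε : 0 < ε) (hδ : 0 < δ) (r : ℝ) :
    ContDiff ℝ (⊤ : ℕ∞) (truncPrimitive ε δ r) := by
  refine contDiff_infty_iff_deriv.mpr ⟨fun t => ?_, ?_⟩
  · exact intervalIntegral.differentiable_integral_of_continuous
      (contDiff_truncSq_rpow hε hδ r).continuous t
  · rw [deriv_truncPrimitive hε hδ]
    exact contDiff_truncSq_rpow hε hδ r

theorem abs_mul_truncPrimitive_le (hε : 0 < ε) (hδ : 0 < δ) {r : ℝ} (hr : 0 ≤ r) (t : ℝ) :
    |t * truncPrimitive ε δ r t| ≤ t ^ 2 * truncSq ε δ t ^ r := by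
  have habs : |truncPrimitive ε δ r t| ≤ truncSq ε δ t ^ r * |t - 0| := by
    rw [← Real.norm_eq_abs]
    refine intervalIntegral.norm_integral_le_of_norm_le_const fun x hx => ?_
    rw [Real.norm_of_nonneg (Real.rpow_nonneg (truncSq_pos hε hδ x).le _)]
    refine Real.rpow_le_rpow (truncSq_pos hε hδ x).le (truncSq_le_truncSq hδ ?_) hr
    simpa using Set.abs_sub_left_of_mem_uIcc (Set.uIoc_subset_uIcc hx)
  rw [sub_zero] at habs
  rw [abs_mul, ← sq_abs t]
  calc |t| * |truncPrimitive ε δ r t| ≤ |t| * (truncSq ε δ t ^ r * |t|) := by gcongr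
    _ = |t| ^ 2 * truncSq ε δ t ^ r := by ring

theorem isAdmissibleTest_truncPrimitive (hε : 0 < ε) (hδ : 0 < δ) {r : ℝ} (hr : 0 ≤ r) :
    IsAdmissibleTest (truncPrimitive ε δ r) where
  contDiff := contDiff_truncPrimitive hε hδ r
  map_zero := intervalIntegral.integral_same
  deriv_nonneg t := by
    rw [deriv_truncPrimitive hε hδ]
    exact Real.rpow_nonneg (truncSq_pos hε hδ t).le _
  lipschitz := by
    refine ⟨((ε + 1 / δ) ^ r).toNNReal, lipschitzWith_of_nnnorm_deriv_le
      ((contDiff_truncPrimitive hε hδ r).differentiable (by simp)) fun t => ?_⟩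
    rw [← norm_toNNReal, deriv_truncPrimitive hε hδ,
      Real.norm_of_nonneg (Real.rpow_nonneg (truncSq_pos hε hδ t).le _)]
    exact Real.toNNReal_le_toNNReal (truncSq_rpow_le_add_one_div_rpow hε hδ hr t)
  abs_mul_le t := by
    rw [deriv_truncPrimitive hε hδ]
    exact abs_mul_truncPrimitive_le hε hδ hr t

end Truncation

section MoserIteration

variable {α : Type*} [MeasurableSpace α] {μ : Measure α} {v : α → ℝ} {p χ : ℝ}

theorem eLpNorm_top_le_of_forall_le (hv : AEStronglyMeasurable v μ) {q : ℕ → ℝ}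
    (hq0 : ∀ k, 0 < q k) (hq : Tendsto q atTop atTop) {K : ℝ≥0∞}
    (h : ∀ k, eLpNorm v (ENNReal.ofReal (q k)) μ ≤ K) : eLpNorm v ∞ μ ≤ K := by
  refine le_of_forall_gt_imp_ge_of_dense fun b hb => ?_
  rcases eq_or_ne b ∞ with rfl | hbtop
  · exact le_top
  have hb0 : b ≠ 0 := (pos_of_gt hb).ne'
  have hmarkov : ∀ k, μ {x | b ≤ ‖v x‖ₑ} ≤ (K / b) ^ q k := fun k => by
    have hcheb := mul_meas_ge_le_pow_eLpNorm' μ (p := ENNReal.ofReal (q k))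
      (by simpa using hq0 k) ENNReal.ofReal_ne_top hv b
    rw [ENNReal.toReal_ofReal (hq0 k).le] at hcheb
    rw [ENNReal.div_rpow_of_nonneg _ _ (hq0 k).le,
      ENNReal.le_div_iff_mul_le (.inl (by simp [ENNReal.rpow_eq_zero_iff, hb0, hbtop]))
        (.inl (ENNReal.rpow_ne_top_of_nonneg (hq0 k).le hbtop)), mul_comm]
    exact hcheb.trans (ENNReal.rpow_le_rpow (h k) (hq0 k).le)
  have hratio : K / b < 1 := ENNReal.div_lt_of_lt_mul (by rwa [one_mul])
  have hnull : μ {x | b ≤ ‖v x‖ₑ} = 0 := le_antisymm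
    (ge_of_tendsto' ((ENNReal.tendsto_rpow_atTop_of_base_lt_one hratio).comp hq) hmarkov) zero_le
  have hae : ∀ᵐ x ∂μ, ¬ b ≤ ‖v x‖ₑ := by simpa only [ae_iff, not_not] using hnull
  rw [eLpNorm_exponent_top]
  exact essSup_le_of_ae_le _ (hae.mono fun x hx => (not_le.mp hx).le)

theorem summable_inv_pow_mul_add (hχ : 1 < χ) (a b : ℝ) :
    Summable fun k : ℕ => χ⁻¹ ^ k * (a + k * b) := by
  have hr : ‖χ⁻¹‖ < 1 := by
    rw [Real.norm_of_nonneg (by positivity)]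
    exact inv_lt_one_of_one_lt₀ hχ
  refine (((summable_geometric_of_norm_lt_one hr).mul_right a).add
    ((summable_pow_mul_geometric_of_norm_lt_one 1 hr).mul_right b)).congr fun k => ?_
  ring

theorem mul_ofReal_pow_rpow_le_exp {C : ℝ≥0} {D : ℝ} (hD : 0 < D) (hCD : C ≤ D) (hχ : 0 < χ)
    (k : ℕ) : ((C : ℝ≥0∞) * ENNReal.ofReal (χ ^ k)) ^ (1 / χ ^ k) ≤
      ENNReal.ofReal (Real.exp (χ⁻¹ ^ k * (Real.log D + k * Real.log χ))) := by
  have hk : 0 < χ ^ k := by positivity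
  calc ((C : ℝ≥0∞) * ENNReal.ofReal (χ ^ k)) ^ (1 / χ ^ k)
      ≤ ENNReal.ofReal (D * χ ^ k) ^ (1 / χ ^ k) := by
        rw [ENNReal.ofReal_mul hD.le, ← ENNReal.ofReal_coe_nnreal]
        gcongr
    _ = ENNReal.ofReal (Real.exp (χ⁻¹ ^ k * (Real.log D + k * Real.log χ))) := by
        rw [ENNReal.ofReal_rpow_of_pos (by positivity), Real.rpow_def_of_pos (by positivity),
          Real.log_mul hD.ne' hk.ne', Real.log_pow, mul_comm, one_div, inv_pow]

theorem le_exp_sum_mul_of_forall_succ_le {a : ℕ → ℝ≥0∞} {e : ℕ → ℝ}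
    (h : ∀ k, a (k + 1) ≤ ENNReal.ofReal (Real.exp (e k)) * a k) (k : ℕ) :
    a k ≤ ENNReal.ofReal (Real.exp (∑ i ∈ Finset.range k, e i)) * a 0 := by
  induction k with
  | zero => simp
  | succ k ih =>
    calc a (k + 1) ≤ ENNReal.ofReal (Real.exp (e k)) *
          (ENNReal.ofReal (Real.exp (∑ i ∈ Finset.range k, e i)) * a 0) := (h k).trans (by gcongr)
      _ = ENNReal.ofReal (Real.exp (∑ i ∈ Finset.range (k + 1), e i)) * a 0 := by
        rw [← mul_assoc, ← ENNReal.ofReal_mul (Real.exp_pos _).le, ← Real.exp_add,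
          Finset.sum_range_succ, add_comm]

theorem exists_eLpNorm_top_le_of_moser (hχ : 1 < χ) (hp : 0 < p) (C : ℝ≥0) (μ : Measure α) :
    ∃ P : ℝ≥0, ∀ v : α → ℝ, AEStronglyMeasurable v μ →
      (∀ s : ℝ, 1 ≤ s → eLpNorm v (ENNReal.ofReal (χ * p * s)) μ ≤
        (C * ENNReal.ofReal s) ^ (1 / s) * eLpNorm v (ENNReal.ofReal (p * s)) μ) →
      eLpNorm v ∞ μ ≤ P * eLpNorm v (ENNReal.ofReal p) μ := by
  have hχ0 : 0 < χ := by linarith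
  set D : ℝ := max C 1
  have hD : 1 ≤ D := le_max_right _ _
  set e : ℕ → ℝ := fun k => χ⁻¹ ^ k * (Real.log D + k * Real.log χ)
  have he0 : ∀ k, 0 ≤ e k := fun k => by
    have := Real.log_nonneg hD
    have := Real.log_nonneg hχ.le
    positivity
  refine ⟨(Real.exp (∑' k, e k)).toNNReal, fun v hv hstep => ?_⟩
  refine eLpNorm_top_le_of_forall_le hv (q := fun k => p * χ ^ k) (fun k => by positivity)
    ((tendsto_pow_atTop_atTop_of_one_lt hχ).const_mul_atTop hp) fun k => ?_
  have hgain : ∀ k : ℕ, eLpNorm v (ENNReal.ofReal (p * χ ^ (k + 1))) μ ≤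
      ENNReal.ofReal (Real.exp (e k)) * eLpNorm v (ENNReal.ofReal (p * χ ^ k)) μ := fun k =>
    calc eLpNorm v (ENNReal.ofReal (p * χ ^ (k + 1))) μ
        = eLpNorm v (ENNReal.ofReal (χ * p * χ ^ k)) μ := by ring_nf
      _ ≤ _ := hstep (χ ^ k) (one_le_pow₀ hχ.le)
      _ ≤ _ := by
        gcongr
        exact mul_ofReal_pow_rpow_le_exp (by positivity) (le_max_left _ _) hχ0 k
  refine (le_exp_sum_mul_of_forall_succ_le
    (a := fun k => eLpNorm v (ENNReal.ofReal (p * χ ^ k)) μ) hgain k).trans ?_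
  rw [pow_zero, mul_one, ← ENNReal.ofReal]
  gcongr
  exact (summable_inv_pow_mul_add hχ _ _).sum_le_tsum _ fun i _ => he0 i

end MoserIteration

section MoserStep

variable {α E : Type*} [MeasurableSpace α] {μ : Measure α} [NormedAddCommGroup E]
  {p ε δ s : ℝ} {ω : α → ℝ} {G : α → E} {C : ℝ≥0}

theorem truncSq_rpow_le_add_sq_rpow (hε : 0 < ε) (hδ : 0 < δ) {r : ℝ} (hr : 0 ≤ r) (t : ℝ) :
    truncSq ε δ t ^ r ≤ (ε + t ^ 2) ^ r :=
  Real.rpow_le_rpow (truncSq_pos hε hδ t).le (truncSq_le hδ t) hr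

theorem norm_rpow_mul_truncSq_rpow_le (hp : 0 < p) (hε : 0 < ε) (hδ : 0 < δ) (hs : 1 ≤ s)
    (t : ℝ) :
    ‖t‖ ^ p * truncSq ε δ t ^ ((s - 1) * p / 2) ≤ ‖(ε + t ^ 2) ^ (s / 2)‖ ^ p := by
  have : 0 ≤ s - 1 := by linarith
  have hpos : 0 < ε + t ^ 2 := by positivity
  calc ‖t‖ ^ p * truncSq ε δ t ^ ((s - 1) * p / 2)
      ≤ (ε + t ^ 2) ^ (p / 2) * (ε + t ^ 2) ^ ((s - 1) * p / 2) := by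
        gcongr ?_ * ?_
        · exact Real.rpow_nonneg (truncSq_pos hε hδ t).le _
        · rw [← sq_rpow_half (norm_nonneg t), Real.norm_eq_abs, sq_abs]
          gcongr
          exact le_add_of_nonneg_left hε.le
        · exact truncSq_rpow_le_add_sq_rpow hε hδ (by positivity) t
    _ = ‖(ε + t ^ 2) ^ (s / 2)‖ ^ p := by
        rw [Real.norm_of_nonneg (by positivity), ← Real.rpow_mul hpos.le, ← Real.rpow_add hpos]
        ring_nf

theorem lintegral_enorm_rpow_mul_truncSq_rpow_le (hp : 0 < p) (hε : 0 < ε) (hδ : 0 < δ)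
    (hs : 1 ≤ s) :
    ∫⁻ x, ‖ω x‖ₑ ^ p * ENNReal.ofReal (truncSq ε δ (ω x) ^ ((s - 1) * p / 2)) ∂μ ≤
      eLpNorm (fun x => (ε + ω x ^ 2) ^ (s / 2)) (ENNReal.ofReal p) μ ^ p := by
  rw [eLpNorm_eq_lintegral_rpow_enorm_toReal (by simpa using hp) ENNReal.ofReal_ne_top,
    ENNReal.toReal_ofReal hp.le, ← ENNReal.rpow_mul, one_div_mul_cancel hp.ne', ENNReal.rpow_one]
  refine lintegral_mono fun x => ?_
  rw [← ofReal_norm, ← ofReal_norm, ENNReal.ofReal_rpow_of_nonneg (norm_nonneg _) hp.le,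
    ENNReal.ofReal_rpow_of_nonneg (norm_nonneg _) hp.le, ← ENNReal.ofReal_mul (by positivity)]
  exact ENNReal.ofReal_le_ofReal (norm_rpow_mul_truncSq_rpow_le hp hε hδ hs _)

theorem enorm_deriv_truncSq_rpow_smul_rpow_le [NormedSpace ℝ E] (hp : 0 < p) (hε : 0 < ε)
    (hδ : 0 < δ) (hs : 0 ≤ s) (t : ℝ) (g : E) :
    ‖deriv (fun t => truncSq ε δ t ^ (s / 2)) t • g‖ₑ ^ p ≤
      ENNReal.ofReal s ^ p * (‖g‖ₑ ^ p * ENNReal.ofReal (truncSq ε δ t ^ ((s - 1) * p / 2))) := by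
  have hpos := (truncSq_pos hε hδ t).le
  calc ‖deriv (fun t => truncSq ε δ t ^ (s / 2)) t • g‖ₑ ^ p
      ≤ (ENNReal.ofReal (s * truncSq ε δ t ^ ((s - 1) / 2)) * ‖g‖ₑ) ^ p := by
        rw [enorm_smul, Real.enorm_eq_ofReal_abs]
        gcongr
        exact abs_deriv_truncSq_rpow_le hε hδ hs t
    _ = _ := by
        rw [ENNReal.ofReal_mul hs, ENNReal.mul_rpow_of_nonneg _ _ hp.le,
          ENNReal.mul_rpow_of_nonneg _ _ hp.le,
          ENNReal.ofReal_rpow_of_nonneg (Real.rpow_nonneg hpos _) hp.le, ← Real.rpow_mul hpos]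
        ring_nf

theorem WeightedEnergyBound.eLpNorm_deriv_truncSq_rpow_smul_le [NormedSpace ℝ E]
    (h : WeightedEnergyBound μ p C ω G) (hp : 0 < p) (hε : 0 < ε) (hδ : 0 < δ) (hs : 1 ≤ s) :
    eLpNorm (fun x => deriv (fun t => truncSq ε δ t ^ (s / 2)) (ω x) • G x) (ENNReal.ofReal p) μ ≤
      ENNReal.ofReal s * (C : ℝ≥0∞) ^ (1 / p) *
        eLpNorm (fun x => (ε + ω x ^ 2) ^ (s / 2)) (ENNReal.ofReal p) μ := by
  have : 0 ≤ s - 1 := by linarith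
  have hcancel : ∀ x : ℝ≥0∞, (x ^ p) ^ (1 / p) = x := fun x => by
    rw [← ENNReal.rpow_mul, mul_one_div_cancel hp.ne', ENNReal.rpow_one]
  have henergy := h _ (isAdmissibleTest_truncPrimitive hε hδ (r := (s - 1) * p / 2) (by positivity))
  rw [deriv_truncPrimitive hε hδ] at henergy
  rw [eLpNorm_eq_lintegral_rpow_enorm_toReal (by simpa using hp) ENNReal.ofReal_ne_top,
    ENNReal.toReal_ofReal hp.le]
  set Y := eLpNorm (fun x => (ε + ω x ^ 2) ^ (s / 2)) (ENNReal.ofReal p) μ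
  calc (∫⁻ x, ‖deriv (fun t => truncSq ε δ t ^ (s / 2)) (ω x) • G x‖ₑ ^ p ∂μ) ^ (1 / p)
      ≤ (∫⁻ x, ENNReal.ofReal s ^ p * (‖G x‖ₑ ^ p *
          ENNReal.ofReal (truncSq ε δ (ω x) ^ ((s - 1) * p / 2))) ∂μ) ^ (1 / p) := by
        gcongr with x
        exact enorm_deriv_truncSq_rpow_smul_rpow_le hp hε hδ (by linarith) _ _
    _ ≤ (ENNReal.ofReal s ^ p * (C * Y ^ p)) ^ (1 / p) := by
        rw [lintegral_const_mul' _ _ (by finiteness)]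
        gcongr
        refine henergy.trans ?_
        gcongr
        exact lintegral_enorm_rpow_mul_truncSq_rpow_le hp hε hδ hs
    _ = ENNReal.ofReal s * (C : ℝ≥0∞) ^ (1 / p) * Y := by
        rw [ENNReal.mul_rpow_of_nonneg _ _ (by positivity),
          ENNReal.mul_rpow_of_nonneg _ _ (by positivity), hcancel, hcancel, mul_assoc]

theorem eLpNorm_add_sq_rpow_half (hε : 0 ≤ ε) (hs : 0 < s) {q : ℝ} (hq : 0 < q) :
    eLpNorm (fun x => (ε + ω x ^ 2) ^ (s / 2)) (ENNReal.ofReal q) μ =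
      eLpNorm (fun x => √(ε + ω x ^ 2)) (ENNReal.ofReal (q * s)) μ ^ s := by
  rw [ENNReal.ofReal_mul hq.le, ← eLpNorm_norm_rpow _ hs]
  congr 1 with x
  rw [Real.norm_of_nonneg (Real.sqrt_nonneg _), ← sq_rpow_half (Real.sqrt_nonneg _),
    Real.sq_sqrt (by positivity)]

theorem eLpNorm_sqrt_add_sq_le (hp : 1 ≤ p) (hε : 0 ≤ ε)
    (hω : AEStronglyMeasurable ω μ) :
    eLpNorm (fun x => √(ε + ω x ^ 2)) (ENNReal.ofReal p) μ ≤
      eLpNorm ω (ENNReal.ofReal p) μ + ENNReal.ofReal √ε * μ Set.univ ^ (1 / p) := by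
  calc eLpNorm (fun x => √(ε + ω x ^ 2)) (ENNReal.ofReal p) μ
      ≤ eLpNorm ((fun x => ‖ω x‖) + fun _ => √ε) (ENNReal.ofReal p) μ := by
        refine eLpNorm_mono fun x => ?_
        rw [Real.norm_of_nonneg (Real.sqrt_nonneg _), Pi.add_apply,
          Real.norm_of_nonneg (by positivity)]
        refine Real.sqrt_le_iff.mpr ⟨by positivity, ?_⟩
        rw [← sq_abs (ω x), ← Real.norm_eq_abs]
        nlinarith [Real.sq_sqrt hε, mul_nonneg (norm_nonneg (ω x)) (Real.sqrt_nonneg ε)]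
    _ ≤ eLpNorm (fun x => ‖ω x‖) (ENNReal.ofReal p) μ +
          eLpNorm (fun _ => √ε) (ENNReal.ofReal p) μ :=
        eLpNorm_add_le hω.norm aestronglyMeasurable_const (by simpa using hp)
    _ = eLpNorm ω (ENNReal.ofReal p) μ + ENNReal.ofReal √ε * μ Set.univ ^ (1 / p) := by
        rw [eLpNorm_norm, eLpNorm_const' _ (by simpa using by linarith) ENNReal.ofReal_ne_top,
          Real.enorm_of_nonneg (Real.sqrt_nonneg _), ENNReal.toReal_ofReal (by linarith)]

theorem eLpNorm_top_le_of_forall_sqrt_add_sq [IsFiniteMeasure μ] (hp : 1 ≤ p)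
    (hω : AEStronglyMeasurable ω μ)
    (h : ∀ ε : ℝ, 0 < ε → eLpNorm (fun x => √(ε + ω x ^ 2)) ∞ μ ≤
      C * eLpNorm (fun x => √(ε + ω x ^ 2)) (ENNReal.ofReal p) μ) :
    eLpNorm ω ∞ μ ≤ C * eLpNorm ω (ENNReal.ofReal p) μ := by
  have hbound : ∀ ε : ℝ, 0 < ε → eLpNorm ω ∞ μ ≤
      C * (eLpNorm ω (ENNReal.ofReal p) μ + ENNReal.ofReal √ε * μ Set.univ ^ (1 / p)) := by
    intro ε hε
    refine (eLpNorm_mono fun x => ?_).trans ((h ε hε).trans ?_)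
    · rw [Real.norm_of_nonneg (Real.sqrt_nonneg _)]
      exact Real.abs_le_sqrt (le_add_of_nonneg_left hε.le)
    · gcongr
      exact eLpNorm_sqrt_add_sq_le hp hε.le hω
  have hsqrt : Tendsto (fun ε => ENNReal.ofReal √ε) (𝓝[>] 0) (𝓝 0) := by
    simpa using (ENNReal.tendsto_ofReal (Real.continuous_sqrt.tendsto 0)).mono_left
      nhdsWithin_le_nhds
  have hlim : Tendsto (fun ε : ℝ => C * (eLpNorm ω (ENNReal.ofReal p) μ +
      ENNReal.ofReal √ε * μ Set.univ ^ (1 / p))) (𝓝[>] 0)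
      (𝓝 (C * eLpNorm ω (ENNReal.ofReal p) μ)) := by
    simpa using ENNReal.Tendsto.const_mul (tendsto_const_nhds.add
      (ENNReal.Tendsto.mul_const hsqrt (.inr (by finiteness)))) (.inr ENNReal.coe_ne_top)
  exact ge_of_tendsto hlim (eventually_mem_nhdsWithin.mono hbound)

end MoserStep

section HolderLimits

variable {X : Type*} [PseudoMetricSpace X] {γ : ℝ} {A : ℝ≥0∞} {a : ℕ → ℝ≥0∞}

theorem exists_tendsto_hyperfilter_of_enorm_le (hA : A ≠ ∞) (ha : Tendsto a atTop (𝓝 A))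
    {f : ℕ → ℝ} (hf : ∀ n, ‖f n‖ₑ ≤ a n) : ∃ y, Tendsto f (hyperfilter ℕ) (𝓝 y) := by
  have hev : ∀ᶠ n in (hyperfilter ℕ : Filter ℕ), a n < A + 1 :=
    (ha.mono_left Nat.hyperfilter_le_atTop).eventually
      (gt_mem_nhds (ENNReal.lt_add_right hA one_ne_zero))
  have hmem : closedBall (0 : ℝ) (A + 1).toReal ∈ (hyperfilter ℕ).map f := by
    refine hev.mono fun n hn => ?_
    rw [mem_closedBall_zero_iff, ← toReal_enorm]
    exact ENNReal.toReal_mono (by finiteness) ((hf n).trans hn.le)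
  obtain ⟨y, -, hy⟩ := (isCompact_closedBall _ _).ultrafilter_le_nhds' _ hmem
  exact ⟨y, hy⟩

-- Limits along an ultrafilter provide a representative that is defined at every point.
theorem exists_holderBoundedBy_ae_eq [MeasurableSpace X] {μ : Measure X} (hγ : 0 ≤ γ)
    (hA : A ≠ ∞) (ha : Tendsto a atTop (𝓝 A)) {φ : ℕ → X → ℝ} {ω : X → ℝ}
    (hφ : ∀ n, HolderBoundedBy γ (a n) (φ n))
    (hω : ∀ᵐ x ∂μ, Tendsto (fun n => φ n x) atTop (𝓝 (ω x))) :
    ∃ u : X → ℝ, u =ᵐ[μ] ω ∧ HolderBoundedBy γ A u := by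
  choose u hu using fun x =>
    exists_tendsto_hyperfilter_of_enorm_le hA ha fun n => (hφ n).enorm_le x
  have ha' := ha.mono_left Nat.hyperfilter_le_atTop
  refine ⟨u, ?_, fun x => ?_, fun x y => ?_⟩
  · filter_upwards [hω] with x hx
    exact tendsto_nhds_unique (hu x) (hx.mono_left Nat.hyperfilter_le_atTop)
  · exact le_of_tendsto_of_tendsto' (hu x).enorm ha' fun n => (hφ n).enorm_le x
  · exact le_of_tendsto_of_tendsto' ((hu x).edist (hu y)) (ENNReal.Tendsto.mul_const ha'
      (.inr (ENNReal.rpow_ne_top_of_nonneg hγ (edist_ne_top x y)))) fun n => (hφ n).edist_le x y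

theorem HolderBoundedBy.holderNormOn_le {N : ℕ} {u : USphere N → ℝ} (h : HolderBoundedBy γ A u)
    (hγ : 0 ≤ γ) (hA : A ≠ ∞) (S : Set (USphere N)) : holderNormOn γ S u ≤ 2 * A := by
  have hholder : HolderWith A.toNNReal γ.toNNReal (S.domRestrict u) := fun x y => by
    rw [ENNReal.coe_toNNReal hA, Real.coe_toNNReal _ hγ]
    exact h.edist_le x y
  rw [two_mul]
  exact add_le_add (iSup₂_le fun x _ => h.enorm_le x)
    (hholder.eHolderNorm_le.trans_eq (ENNReal.coe_toNNReal hA))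

end HolderLimits

section Regularity

variable {N : ℕ} {p : ℝ} {ω : USphere N → ℝ} {G : USphere N → EuclideanSpace ℝ (Fin N)}
  {C₁ C₂ : ℝ≥0}

theorem eLpNorm_truncSq_rpow_le (hp : 1 ≤ p) {q : ℝ} (hC₁ : SphereSobolev N p q C₁)
    (hω : HasW0Gradient p Set.univ ω G) (hC₂ : WeightedEnergyBound (surfaceMeasure N) p C₂ ω G)
    {ε δ s : ℝ} (hε : 0 < ε) (hδ : 0 < δ) (hs : 1 ≤ s) :
    eLpNorm (fun σ => truncSq ε δ (ω σ) ^ (s / 2)) (ENNReal.ofReal q) (surfaceMeasure N) ≤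
      C₁ * (1 + (C₂ : ℝ≥0∞) ^ (1 / p)) * ENNReal.ofReal s *
        eLpNorm (fun σ => (ε + ω σ ^ 2) ^ (s / 2)) (ENNReal.ofReal p) (surfaceMeasure N) := by
  obtain ⟨L, hL⟩ := exists_lipschitzWith_truncSq_rpow hε hδ hs
  have hgrad := hC₂.eLpNorm_deriv_truncSq_rpow_smul_le (by linarith) hε hδ hs
  set Y := eLpNorm (fun σ => (ε + ω σ ^ 2) ^ (s / 2)) (ENNReal.ofReal p) (surfaceMeasure N)
  have hval : eLpNorm (fun σ => truncSq ε δ (ω σ) ^ (s / 2)) (ENNReal.ofReal p)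
      (surfaceMeasure N) ≤ ENNReal.ofReal s * Y := by
    refine (eLpNorm_mono_real fun σ => ?_).trans
      (le_mul_of_one_le_left' (ENNReal.one_le_ofReal.mpr hs))
    rw [Real.norm_of_nonneg (Real.rpow_nonneg (truncSq_pos hε hδ _).le _)]
    exact truncSq_rpow_le_add_sq_rpow hε hδ (by linarith) _
  calc eLpNorm (fun σ => truncSq ε δ (ω σ) ^ (s / 2)) (ENNReal.ofReal q) (surfaceMeasure N)
      ≤ C₁ * (ENNReal.ofReal s * Y + ENNReal.ofReal s * (C₂ : ℝ≥0∞) ^ (1 / p) * Y) :=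
        ((hω.comp_univ hp (contDiff_truncSq_rpow hε hδ _) hL).eLpNorm_le_of_sphereSobolev hp
          hC₁).trans (mul_le_mul_right (add_le_add hval hgrad) _)
    _ = C₁ * (1 + (C₂ : ℝ≥0∞) ^ (1 / p)) * ENNReal.ofReal s * Y := by ring

theorem eLpNorm_add_sq_rpow_le (hp : 1 ≤ p) {q : ℝ} (hC₁ : SphereSobolev N p q C₁)
    (hω : HasW0Gradient p Set.univ ω G) (hC₂ : WeightedEnergyBound (surfaceMeasure N) p C₂ ω G)
    {ε s : ℝ} (hε : 0 < ε) (hs : 1 ≤ s) :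
    eLpNorm (fun σ => (ε + ω σ ^ 2) ^ (s / 2)) (ENNReal.ofReal q) (surfaceMeasure N) ≤
      C₁ * (1 + (C₂ : ℝ≥0∞) ^ (1 / p)) * ENNReal.ofReal s *
        eLpNorm (fun σ => (ε + ω σ ^ 2) ^ (s / 2)) (ENNReal.ofReal p) (surfaceMeasure N) := by
  have hmeas := hω.memLp.1
  rw [Measure.restrict_univ] at hmeas
  exact Lp.eLpNorm_le_of_ae_tendsto
    (Eventually.of_forall fun n : ℕ =>
      eLpNorm_truncSq_rpow_le hp hC₁ hω hC₂ hε (δ := 1 / ((n : ℝ) + 1)) (by positivity) hs)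
    (fun n => (contDiff_truncSq_rpow hε (by positivity) _).continuous.comp_aestronglyMeasurable
      hmeas)
    (ae_of_all _ fun σ => (tendsto_truncSq ε (ω σ)).rpow_const (.inr (by linarith)))

theorem eLpNorm_sqrt_add_sq_le_rpow_mul (hp : 1 ≤ p) {q : ℝ} (hq : 0 < q)
    (hC₁ : SphereSobolev N p q C₁) (hω : HasW0Gradient p Set.univ ω G)
    (hC₂ : WeightedEnergyBound (surfaceMeasure N) p C₂ ω G) {ε s : ℝ} (hε : 0 < ε) (hs : 1 ≤ s) :
    eLpNorm (fun σ => √(ε + ω σ ^ 2)) (ENNReal.ofReal (q * s)) (surfaceMeasure N) ≤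
      (C₁ * (1 + (C₂ : ℝ≥0∞) ^ (1 / p)) * ENNReal.ofReal s) ^ (1 / s) *
        eLpNorm (fun σ => √(ε + ω σ ^ 2)) (ENNReal.ofReal (p * s)) (surfaceMeasure N) := by
  have hs0 : 0 < s := by linarith
  have hpow := eLpNorm_add_sq_rpow_le hp hC₁ hω hC₂ hε hs
  rw [eLpNorm_add_sq_rpow_half hε.le hs0 hq,
    eLpNorm_add_sq_rpow_half hε.le hs0 (by linarith)] at hpow
  have hroot := ENNReal.rpow_le_rpow hpow (one_div_nonneg.mpr hs0.le)
  rwa [ENNReal.mul_rpow_of_nonneg _ _ (one_div_nonneg.mpr hs0.le), ← ENNReal.rpow_mul,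
    ← ENNReal.rpow_mul, mul_one_div_cancel hs0.ne', ENNReal.rpow_one, ENNReal.rpow_one] at hroot

theorem exists_eLpNorm_top_le_of_weightedEnergyBound (hp : 1 ≤ p) (hpN : p < N) (C₂ : ℝ≥0) :
    ∃ C : ℝ≥0, ∀ (ω : USphere N → ℝ) (G : USphere N → EuclideanSpace ℝ (Fin N)),
      HasW0Gradient p Set.univ ω G → WeightedEnergyBound (surfaceMeasure N) p C₂ ω G →
      eLpNorm ω ∞ (surfaceMeasure N) ≤ C * eLpNorm ω (ENNReal.ofReal p) (surfaceMeasure N) := by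
  have hp0 : 0 < p := by linarith
  have hχ : 1 < N / (N - p) := by
    rw [one_lt_div (by linarith)]
    linarith
  obtain ⟨C₁, hC₁⟩ := exists_sphereSobolev hp hpN
  have hD : C₁ * (1 + (C₂ : ℝ≥0∞) ^ (1 / p)) ≠ ∞ := by finiteness
  obtain ⟨C, hC⟩ := exists_eLpNorm_top_le_of_moser hχ hp0
    (C₁ * (1 + (C₂ : ℝ≥0∞) ^ (1 / p))).toNNReal (surfaceMeasure N)
  rw [ENNReal.coe_toNNReal hD] at hC
  refine ⟨C, fun ω G hω hC₂ => ?_⟩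
  have hmeas := hω.memLp.1
  rw [Measure.restrict_univ] at hmeas
  exact eLpNorm_top_le_of_forall_sqrt_add_sq hp hmeas fun ε hε =>
    hC _ (Real.continuous_sqrt.comp_aestronglyMeasurable
      (aestronglyMeasurable_const.add (hmeas.pow 2))) fun s hs =>
      eLpNorm_sqrt_add_sq_le_rpow_mul hp (by positivity) hC₁ hω hC₂ hε hs

theorem exists_holderBoundedBy_of_weightedEnergyBound (hp : 1 ≤ p) (hNp : (N : ℝ) - 1 < p)
    (C₂ : ℝ≥0) :
    ∃ C : ℝ≥0, ∀ (ω : USphere N → ℝ) (G : USphere N → EuclideanSpace ℝ (Fin N)),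
      HasW0Gradient p Set.univ ω G → WeightedEnergyBound (surfaceMeasure N) p C₂ ω G →
      ∃ u : USphere N → ℝ, u =ᵐ[surfaceMeasure N] ω ∧ HolderBoundedBy (1 - ((N : ℝ) - 1) / p)
        (C * eLpNorm ω (ENNReal.ofReal p) (surfaceMeasure N)) u := by
  have hp0 : 0 < p := by linarith
  obtain ⟨C₁, hC₁⟩ := exists_holderBoundedBy_sphere N hp hNp
  have hD : C₁ * (1 + (C₂ : ℝ≥0∞) ^ (1 / p)) ≠ ∞ := by finiteness
  refine ⟨(C₁ * (1 + (C₂ : ℝ≥0∞) ^ (1 / p))).toNNReal, fun ω G hω hC₂ => ?_⟩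
  obtain ⟨φ, hφ, hnorm, hae⟩ := hω.exists_seq_tendsto_sobolevENorm hp
  have hmem := hω.memLp
  rw [Measure.restrict_univ] at hmem
  have hsobolev : sobolevENorm p ω G ≤
      (1 + (C₂ : ℝ≥0∞) ^ (1 / p)) * eLpNorm ω (ENNReal.ofReal p) (surfaceMeasure N) := by
    rw [add_mul, one_mul]
    exact add_le_add_right (hC₂.eLpNorm_grad_le hp0) _
  have hfinite : sobolevENorm p ω G ≠ ∞ :=
    (hsobolev.trans_lt (ENNReal.mul_lt_top (by finiteness) hmem.2)).ne
  obtain ⟨u, hu, hholder⟩ := exists_holderBoundedBy_ae_eq (one_sub_div_pos hp0 hNp).le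
    (A := C₁ * sobolevENorm p ω G) (by finiteness)
    (ENNReal.Tendsto.const_mul hnorm (.inr ENNReal.coe_ne_top)) (fun n => hC₁ _ (hφ n)) hae
  refine ⟨u, hu, hholder.mono ?_⟩
  rw [ENNReal.coe_toNNReal hD, mul_assoc]
  gcongr

theorem coe_le_ofReal_add_one (C : ℝ≥0) : (C : ℝ≥0∞) ≤ ENNReal.ofReal (C + 1) := by
  rw [← ENNReal.ofReal_coe_nnreal]
  exact ENNReal.ofReal_le_ofReal (by linarith)

theorem lemma2p1_general (N : ℕ) {p : ℝ} (hp : 1 < p) {β lam : ℝ} (hlam : β = 0 → lam = 0) :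
    ∃ c : ℝ, 0 < c ∧
      ∀ S : Set (USphere N), MeasurableSet S →
        ∀ (ω : USphere N → ℝ) (G : USphere N → EuclideanSpace ℝ (Fin N)),
          HasW0Gradient p S ω G → IsWeakSolution p β lam S ω G →
          ((N : ℝ) - 1 < p →
            ∃ u : USphere N → ℝ, u =ᵐ[(surfaceMeasure N).restrict S] ω ∧
              holderNormOn (1 - ((N : ℝ) - 1) / p) S u ≤
                ENNReal.ofReal c *
                  eLpNorm ω (ENNReal.ofReal p) ((surfaceMeasure N).restrict S)) ∧
          (p ≤ (N : ℝ) - 1 →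
            eLpNorm ω ∞ ((surfaceMeasure N).restrict S) ≤
              ENNReal.ofReal c *
                eLpNorm ω (ENNReal.ofReal p) ((surfaceMeasure N).restrict S)) := by
  have hp0 : 0 < p := by linarith
  obtain ⟨C₂, henergy⟩ := exists_weightedEnergyBound N hp hlam
  rcases lt_or_ge ((N : ℝ) - 1) p with hNp | hNp
  · obtain ⟨C, hC⟩ := exists_holderBoundedBy_of_weightedEnergyBound hp.le hNp C₂
    refine ⟨(2 * C : ℝ≥0) + 1, by positivity, fun S hS ω G hω h =>
      ⟨fun _ => ?_, fun hpN => absurd hNp hpN.not_gt⟩⟩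
    obtain ⟨u, hu, hholder⟩ := hC _ _ (hω.indicator hS) ((henergy S ω G hω h).indicator hS hp0)
    refine ⟨u, EventuallyEq.trans (ae_restrict_of_ae hu) (indicator_ae_eq_restrict hS), ?_⟩
    rw [eLpNorm_indicator_eq_eLpNorm_restrict hS] at hholder
    refine (hholder.holderNormOn_le (one_sub_div_pos hp0 hNp).le
      (ENNReal.mul_ne_top ENNReal.coe_ne_top hω.memLp.2.ne) S).trans ?_
    rw [← mul_assoc]
    gcongr
    exact coe_le_ofReal_add_one (2 * C)
  · obtain ⟨C, hC⟩ := exists_eLpNorm_top_le_of_weightedEnergyBound hp.le (by linarith) C₂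
    refine ⟨C + 1, by positivity, fun S hS ω G hω h =>
      ⟨fun hpN => absurd hNp hpN.not_ge, fun _ => ?_⟩⟩
    have hbound := hC _ _ (hω.indicator hS) ((henergy S ω G hω h).indicator hS hp0)
    rw [eLpNorm_indicator_eq_eLpNorm_restrict hS, eLpNorm_indicator_eq_eLpNorm_restrict hS]
      at hbound
    refine hbound.trans ?_
    gcongr
    exact coe_le_ofReal_add_one C

end Regularity

theorem lemma2p1 (N : ℕ) (hN : 2 ≤ N) (p β : ℝ) (hp : 1 < p) :
    ∃ c : ℝ, 0 < c ∧
      ∀ S : Set (USphere N), IsOpen S → IsConnected S →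
        ∀ ω : USphere N → ℝ, IsW0Solution p β S ω →
          ((N : ℝ) - 1 < p →
            ∃ u : USphere N → ℝ, u =ᵐ[(surfaceMeasure N).restrict S] ω ∧
              holderNormOn (1 - ((N : ℝ) - 1) / p) S u ≤
                ENNReal.ofReal c *
                  eLpNorm ω (ENNReal.ofReal p) ((surfaceMeasure N).restrict S)) ∧
          (p ≤ (N : ℝ) - 1 →
            eLpNorm ω ∞ ((surfaceMeasure N).restrict S) ≤
              ENNReal.ofReal c *
                eLpNorm ω (ENNReal.ofReal p) ((surfaceMeasure N).restrict S)) := by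
  obtain ⟨c, hc, h⟩ := lemma2p1_general N hp (β := β) (lam := (p - 1) * β * (β - betaZero N p))
    (fun hβ => by simp [hβ])
  exact ⟨c, hc, fun S hS _ ω ⟨G, hG, hweak⟩ => h S hS.measurableSet ω G hG hweak⟩
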